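/- **Setting.** Let $\mathcal X$ be a metric space with its Borel $\sigma$-algebra and $\rho$ a probability measure on $\mathcal X\times\mathbb R$ (responses may lie in a subset $\mathcal Y\subset\mathbb R$), the law of $(X,Y)$, whose marginal $\rho_X$ on $\mathcal X$ is concentrated on a separable set (automatic if $\mathcal X$ is separable). Assume the regression model $Y=f^*(X)+\epsilon$, where $f^*:\mathcal X\to\mathbb R$ is measurable and, for every $x\in\mathcal X$, the noise $\epsilon$ given $X=x$ has a probability density $p_{\epsilon|X=x}(t)$, jointly measurable in $(x,t)$, with conditional mean $0$ whenever that mean exists. For measurable $f:\mathcal X\to\mathbb R$ let $p_E$ be the density of $E=Y-f(X)$, let $\mathscr R(f)=-\log\int_{\mathbb R}p_E(e)^2\,de$, and for $h>0$ let $G_h(t)=\frac1{\sqrt{2\pi}h}e^{-t^2/(2h^2)}$ and $$\mathcal E_h(f)=-\iint G_h\big((y-f(x))-(y'-f(x'))\big)\,d\rho(x,y)\,d\rho(x',y').$$ *Admissible model.* The densities $p_{\epsilon|X=x}$ are bounded by a constant independent of $x$, $f^*$ is bounded, and $\mathscr R$ attains its minimum over all measurable functions. *Admissible hypothesis space.*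 $\mathcal H$ is a uniformly bounded set of continuous functions on $\mathcal X$ that contains $f^*$ and a minimizer of $\mathscr R$, and there are $c>0$ and $0<s<2$ with $\log\mathcal N_2(\mathcal H,\varepsilon)\le c\,\varepsilon^{-s}$ for all $\varepsilon>0$. Here $\mathcal N_2(\mathcal H,\varepsilon)=\sup_n\sup_{\mathbf x\in\mathcal X^n}\mathcal N(\mathcal H|_{\mathbf x},\varepsilon,d_2)$, where $\mathcal N(S,\varepsilon,d_2)$ is the minimal number of $d_2$-balls in $\mathbb R^n$ of radius $\varepsilon$ covering $S$, $\mathcal H|_{\mathbf x}=\{(f(x_i))_{i=1}^n: f\in\mathcal H\}$ and $d_2(\mathbf a,\mathbf b)=\big(\frac1n\sum_{i=1}^n|a_i-b_i|^2\big)^{1/2}$. *The class $\mathcal P_1$.* $\rho\in\mathcal P_1$ means: for every $x$, $p_{\epsilon|X=x}$ is even and unimodal (increasing on $(-\infty,t_0]$ and decreasing on $[t_0,\infty)$ for some $t_0$); its Fourier transform $\widehat{p_{\epsilon|X=x}}(\xi)=\int p_{\epsilon|X=x}(t)e^{-it\xi}\,dt$ is nonnegative on $\mathbb R$ for every $x$;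 and there are $c_0,C_0>0$ with $\widehat{p_{\epsilon|X=x}}(\xi)\ge C_0$ for all $|\xi|\le c_0$ and all $x$. *The algorithm.* For an i.i.d. sample $\mathbf z=\{(x_i,y_i)\}_{i=1}^n$ from $\rho$, $f_{\mathbf z}$ is a minimizer over $f\in\mathcal H$ of $$\mathscr R_{\mathbf z}(f)=-\log\Big(\frac1{n^2}\sum_{i,j=1}^nG_h(e_i-e_j)\Big),\qquad e_i=y_i-f(x_i)$$ (assumed to exist for almost every sample; when several exist, any choice is allowed). **Theorem.** Let the model and $\mathcal H$ be admissible and $\rho\in\mathcal P_1$. 1. For every $h>0$ and every constant $b\in\mathbb R$, $f^*+b$ minimizes $\mathcal E_h$ among all measurable functions $f:\mathcal X\to\mathbb R$. 2. For every fixed $h>0$, $f_{\mathbf z}+\mathbf E_x(f^*-f_{\mathbf z})$ converges to $f^*$ in probability: for every $\varepsilon>0$, $$\lim_{n\to\infty}\mathbf P\Big(\|f_{\mathbf z}+\mathbf E_x(f^*-f_{\mathbf z})-f^*\|_{L^2_{\rho_X}}^2>\varepsilon\Big)=0,$$ where $\mathbf E_x g=\int g\,d\rho_X$. 3. For every fixed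 $h>0$ there is a constant $C>0$, depending only on $\rho$, $\mathcal H$ and $h$, such that for all $n\ge1$ and $0<\delta<1$, with probability at least $1-\delta$, $$\|f_{\mathbf z}+\mathbf E_x(f^*-f_{\mathbf z})-f^*\|_{L^2_{\rho_X}}^2\le C\sqrt{\log(2/\delta)}\;n^{-1/2}.$$ If $\mathbf z\mapsto f_{\mathbf z}$ is not measurable, probabilities of the failure events in 2 and 3 are outer probabilities. -/

import Mathlib

open MeasureTheory Filter Topology Set
open scoped ENNReal NNReal

noncomputable section

namespace MEE

/-- The Gaussian kernel `G_h(t) = exp(-t² / (2 h²)) / (√(2π) h)`. -/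
def gaussKernel (h t : ℝ) : ℝ :=
  1 / (Real.sqrt (2 * Real.pi) * h) * Real.exp (-t ^ 2 / (2 * h ^ 2))

/-- The Fourier transform with the normalisation `∫ f(t) e^{-i t ξ} dt`. -/
def fourierHat (f : ℝ → ℝ) (ξ : ℝ) : ℂ :=
  ∫ t, (f t : ℂ) * Complex.exp (-(Complex.I * t * ξ))

/-- Increasing on `(-∞, m]` and decreasing on `[m, ∞)` for some `m`. -/
def Unimodal (f : ℝ → ℝ) : Prop :=
  ∃ m : ℝ, MonotoneOn f (Iic m) ∧ AntitoneOn f (Ici m)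

section Model

variable {X : Type*} [MeasurableSpace X]

/-- The law of the error variable `E = Y - f(X)` when `(X, Y)` has law `ρ`. -/
def errorLaw (ρ : Measure (X × ℝ)) (f : X → ℝ) : Measure ℝ :=
  ρ.map (fun z => z.2 - f z.1)

/-- The probability density function `p_E` of the error variable `E = Y - f(X)`. -/
def errorDensity (ρ : Measure (X × ℝ)) (f : X → ℝ) (e : ℝ) : ℝ :=
  ((errorLaw ρ f).rnDeriv volume e).toReal

/-- Rényi's error entropy of order two, `-log ∫ p_E(e)² de`. -/
def renyiEntropy (ρ : Measure (X × ℝ)) (f : X → ℝ) : ℝ :=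
  -Real.log (∫ e, errorDensity ρ f e ^ 2)

/-- `f` minimizes Rényi's error entropy among all measurable functions. -/
def IsEntropyMinimizer (ρ : Measure (X × ℝ)) (f : X → ℝ) : Prop :=
  Measurable f ∧ ∀ g : X → ℝ, Measurable g → renyiEntropy ρ f ≤ renyiEntropy ρ g

/-- The information error
`-∫∫ G_h((y - f(x)) - (y' - f(x'))) dρ(x, y) dρ(x', y')`. -/
def informationError (ρ : Measure (X × ℝ)) (h : ℝ) (f : X → ℝ) : ℝ :=
  -∫ z, ∫ z', gaussKernel h ((z.2 - f z.1) - (z'.2 - f z'.1)) ∂ρ ∂ρ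

/-- `f` minimizes the information error among all measurable functions. -/
def IsInformationErrorMinimizer (ρ : Measure (X × ℝ)) (h : ℝ) (f : X → ℝ) : Prop :=
  Measurable f ∧ ∀ g : X → ℝ, Measurable g → informationError ρ h f ≤ informationError ρ h g

/-- The regression model `Y = f*(X) + ε`, `E(ε | X) = 0`, for `(X, Y)` of law `ρ`, in which `p x`
is the density of the noise `ε` given `X = x`, i.e. `(X, ε)` has density `p` with respect to
`ρ_X ⊗ dt`.  Heavy tailed noise is allowed: the conditional mean vanishes whenever it exists. -/
structure IsRegressionModel (ρ : Measure (X × ℝ)) (fstar : X → ℝ) (p : X → ℝ → ℝ) : Prop where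
  measurable_fstar : Measurable fstar
  measurable_density : Measurable (Function.uncurry p)
  density_nonneg : ∀ x t, 0 ≤ p x t
  lintegral_density : ∀ x, ∫⁻ t, ENNReal.ofReal (p x t) = 1
  law_noise : ρ.map (fun z => (z.1, z.2 - fstar z.1)) =
    (ρ.fst.prod volume).withDensity (fun q => ENNReal.ofReal (p q.1 q.2))
  mean_zero : ∀ x, Integrable (fun t => t * p x t) → ∫ t, t * p x t = 0

/-- MEE admissibility of the regression model. -/
structure IsAdmissibleModel (ρ : Measure (X × ℝ)) (fstar : X → ℝ) (p : X → ℝ → ℝ) : Prop where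
  density_bounded : ∃ Mp : ℝ, ∀ x t, p x t ≤ Mp
  fstar_bounded : ∃ M : ℝ, 0 < M ∧ ∀ x, |fstar x| ≤ M
  exists_entropyMinimizer : ∃ f : X → ℝ, IsEntropyMinimizer ρ f

/-- The noise class `P₁`, as a condition on the conditional noise densities `p x`. -/
structure IsNoiseClassP1 (p : X → ℝ → ℝ) : Prop where
  symmetric : ∀ x t, p x (-t) = p x t
  unimodal : ∀ x, Unimodal (p x)
  fourier_nonneg : ∀ x ξ, (fourierHat (p x) ξ).im = 0 ∧ 0 ≤ (fourierHat (p x) ξ).re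
  fourier_lower : ∃ c₀ C₀ : ℝ, 0 < c₀ ∧ 0 < C₀ ∧
    ∀ x, ∀ ξ ∈ Icc (-c₀) c₀, C₀ ≤ (fourierHat (p x) ξ).re

/-- The constant adjustment `E_x(f* - f)`. -/
def adjustment (ρ : Measure (X × ℝ)) (fstar f : X → ℝ) : ℝ :=
  ∫ x, (fstar x - f x) ∂ρ.fst

/-- The squared distance `‖f + E_x(f* - f) - f*‖²` in `L²(ρ_X)`. -/
def adjustedSqError (ρ : Measure (X × ℝ)) (fstar f : X → ℝ) : ℝ :=
  ∫ x, (f x + adjustment ρ fstar f - fstar x) ^ 2 ∂ρ.fst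

end Model

section Hypothesis

variable {X : Type*}

/-- The `ℓ₂`-norm empirical covering number
`N₂(H, ε) = sup_n sup_{x ∈ Xⁿ} N(H|_x, ε, d₂)`, where
`d₂(a, b) = (n⁻¹ ∑ |a_i - b_i|²)^{1/2}`.  A `d₂`-ball of radius `ε` in `ℝⁿ` is a Euclidean ball
of radius `ε √n`. -/
def empiricalCoveringNumber (H : Set (X → ℝ)) (ε : ℝ≥0) : ℕ∞ :=
  ⨆ (n : ℕ) (x : Fin n → X),
    Metric.externalCoveringNumber (ε * NNReal.sqrt (n : ℝ≥0))
      ((fun f : X → ℝ => (WithLp.toLp 2 (fun i => f (x i)) : EuclideanSpace ℝ (Fin n))) '' H)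

/-- The empirical Rényi entropy of the sample `z`,
`-log (n⁻² ∑_{i,j} G_h(e_i - e_j))` with `e_i = y_i - f(x_i)`. -/
def empiricalEntropy {n : ℕ} (h : ℝ) (z : Fin n → X × ℝ) (f : X → ℝ) : ℝ :=
  -Real.log (1 / (n : ℝ) ^ 2 * ∑ i, ∑ j,
    gaussKernel h (((z i).2 - f (z i).1) - ((z j).2 - f (z j).1)))

/-- `f` is an output of the MEE algorithm on the sample `z`: a minimizer of the empirical entropy
over the hypothesis space `H`. -/
def IsEmpiricalMinimizer {n : ℕ} (H : Set (X → ℝ)) (h : ℝ) (z : Fin n → X × ℝ)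
    (f : X → ℝ) : Prop :=
  f ∈ H ∧ ∀ g ∈ H, empiricalEntropy h z f ≤ empiricalEntropy h z g

/-- `fz` is a version of the MEE algorithm with bandwidth `h`: it assigns to (almost) every sample
of size `n ≥ 1` a minimizer of the empirical entropy over `H`. -/
def IsMEEAlgorithm [MeasurableSpace X] (ρ : Measure (X × ℝ)) (H : Set (X → ℝ)) (h : ℝ)
    (fz : (n : ℕ) → (Fin n → X × ℝ) → X → ℝ) : Prop :=
  ∀ n : ℕ, 1 ≤ n →
    ∀ᵐ z ∂(Measure.pi fun _ : Fin n => ρ), IsEmpiricalMinimizer H h z (fz n z)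

/-- MEE admissibility of a hypothesis space `H` of continuous functions. -/
structure IsAdmissibleSpace [TopologicalSpace X] [MeasurableSpace X] (ρ : Measure (X × ℝ))
    (fstar : X → ℝ) (H : Set (X → ℝ)) : Prop where
  continuous : ∀ f ∈ H, Continuous f
  bounded : ∃ M : ℝ, ∀ f ∈ H, ∀ x, |f x| ≤ M
  covering : ∃ c s : ℝ, 0 < c ∧ 0 < s ∧ s < 2 ∧ ∀ ε : ℝ≥0, 0 < ε →
    ENNReal.log (empiricalCoveringNumber H ε : ℝ≥0∞) ≤ ((c * (ε : ℝ) ^ (-s) : ℝ) : EReal)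
  entropyMinimizer_mem : ∃ f ∈ H, IsEntropyMinimizer ρ f
  fstar_mem : fstar ∈ H

end Hypothesis

end MEE

end

/-! Up to the factor `kernelScale h`, the Gaussian kernel is the characteristic function of N(0,
1/h²) (`freqLaw`). Hence -E_h(f) is that factor times the average over frequencies ξ of |φ_E(ξ)|²,
where φ_E is the characteristic function of the error Y - f(X) (`informationError_eq_errorCharSq`).
Conditioning on X gives φ_E(ξ) = ∫ φ_x(ξ) exp(iξ g(x)) dρ_X(x), with g = f* - f and φ_x ≥ 0 the
characteristic function of the noise. The modulus is largest when the phase is constant, which is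
claim 1.

Quantitatively, the loss of squared modulus is ∬ φ_x φ_y (1 - cos(ξ(g(x) - g(y)))). On a band of low
frequencies, where φ_x ≥ C₀ and the phases stay in [-π/2, π/2], this dominates the variance of g,
and that variance is exactly the adjusted squared error. So the excess of E_h bounds the adjusted
error (`exists_adjustedSqError_le_excess`).

It remains to bound the excess at f_z. Since f_z maximizes the empirical potential over H, which
contains f*, the excess is at most twice the uniform deviation of that potential. The potential is a
double sum, but the real identity cas(u)cas(v) = cos(u - v) + sin(u + v) turns it into a frequency
average of squares of ordinary empirical means, so no decoupling of a U-process is needed. At each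
frequency, symmetrization (`integral_exp_iSup_deviation_le`) and chaining (`sum_exp_chaining_le`,
where s < 2 enters) give a sub-Gaussian moment generating function. Jensen averages it over
frequencies, and Chernoff gives tails (`measure_exists_deviation_le`). This holds for finite
families and passes to H by separability (`measure_exists_mem_deviation_le`). Claim 3 follows, and
claim 3 implies claim 2. -/

namespace MEE

/-! ### Rademacher sums: maximal inequality and chaining -/

/-- The sign `±1` encoded by a Boolean. -/
def boolSign (b : Bool) : ℝ := if b then 1 else -1

/-- The sum over sign vectors factors over coordinates, and each factor is 2 cosh(v i) ≤ 2 exp(v i ²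
/ 2). -/
theorem sum_exp_sign_le {n : ℕ} (v : Fin n → ℝ) :
    ∑ σ : Fin n → Bool, Real.exp (∑ i, boolSign (σ i) * v i) ≤
      2 ^ n * Real.exp ((∑ i, v i ^ 2) / 2) := by
  have h1 : ∑ σ : Fin n → Bool, Real.exp (∑ i, boolSign (σ i) * v i) =
      ∏ i, ∑ b : Bool, Real.exp (boolSign b * v i) := by
    rw [Fintype.prod_sum]
    exact Finset.sum_congr rfl fun σ _ => Real.exp_sum _ _
  rw [h1, Finset.sum_div, Real.exp_sum]
  calc ∏ i, ∑ b : Bool, Real.exp (boolSign b * v i)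
      ≤ ∏ i : Fin n, (2 * Real.exp (v i ^ 2 / 2)) := by
        refine Finset.prod_le_prod (fun i _ => by positivity) fun i _ => ?_
        have := Real.cosh_le_exp_half_sq (v i)
        rw [Real.cosh_eq] at this
        simp only [Fintype.sum_bool, boolSign]
        norm_num
        linarith
    _ = _ := by simp [Finset.prod_mul_distrib]

/-- Maximal inequality for finitely many Rademacher sums, in terms of moment generating
functions. -/
theorem sum_exp_max_le {n : ℕ} (J : Finset (EuclideanSpace ℝ (Fin n))) {b q l : ℝ}
    (hJ : ∀ v ∈ J, ‖v‖ ≤ b) (hq : 1 ≤ q) (hcard : 2 * (J.card : ℝ) ≤ 2 ^ q)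
    (hl : 0 ≤ l) (Y : (Fin n → Bool) → ℝ)
    (hY : ∀ σ, ∃ v ∈ J, Y σ ≤ |∑ i, boolSign (σ i) * v i|) :
    ∑ σ, Real.exp (l * Y σ) ≤ 2 ^ n * (2 * Real.exp (q * (l ^ 2 * b ^ 2 / 2))) := by
  have hq0 : 0 < q := by linarith
  have hexp : ∀ v ∈ J, ∀ e : ℝ, e ^ 2 = 1 →
      ∑ σ : Fin n → Bool, Real.exp (e * (q * l) * ∑ i, boolSign (σ i) * v i) ≤
        2 ^ n * Real.exp (q ^ 2 * (l ^ 2 * b ^ 2 / 2)) := by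
    intro v hv e he
    have := sum_exp_sign_le (fun i => e * (q * l) * v i)
    refine le_trans (le_of_eq ?_) (this.trans ?_)
    · refine Finset.sum_congr rfl fun σ _ => ?_
      rw [Finset.mul_sum]
      congr 1
      exact Finset.sum_congr rfl fun i _ => by ring
    · gcongr
      have h2 : ∑ i, (e * (q * l) * v i) ^ 2 = (q * l) ^ 2 * ‖v‖ ^ 2 := by
        rw [EuclideanSpace.real_norm_sq_eq, Finset.mul_sum]
        exact Finset.sum_congr rfl fun i _ => by rw [mul_pow, mul_pow e, he]; ring
      rw [h2]
      have h3 : ‖v‖ ^ 2 ≤ b ^ 2 := by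
        have := hJ v hv
        gcongr
      have h4 : 0 ≤ (q * l) ^ 2 := sq_nonneg _
      nlinarith [mul_le_mul_of_nonneg_left h3 h4]
  -- The union bound over `J` and both signs is taken for q-th powers: its cost 2|J| ≤ 2^q becomes a
  -- mere factor 2 once the q-th root is extracted.
  have hpow : ∑ σ, Real.exp (l * Y σ) ^ q ≤
      2 ^ n * (2 * Real.exp (q * (l ^ 2 * b ^ 2 / 2))) ^ q := by
    calc ∑ σ, Real.exp (l * Y σ) ^ q
        ≤ ∑ σ : Fin n → Bool, ∑ v ∈ J, (Real.exp (1 * (q * l) * ∑ i, boolSign (σ i) * v i) +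
            Real.exp (-1 * (q * l) * ∑ i, boolSign (σ i) * v i)) := by
          refine Finset.sum_le_sum fun σ _ => ?_
          obtain ⟨v, hv, hle⟩ := hY σ
          refine le_trans ?_ (Finset.single_le_sum (f := fun v : EuclideanSpace ℝ (Fin n) =>
            Real.exp (1 * (q * l) * ∑ i, boolSign (σ i) * v i) +
            Real.exp (-1 * (q * l) * ∑ i, boolSign (σ i) * v i))
            (fun w _ => by positivity) hv)
          rw [← Real.exp_mul]
          have h5 : l * Y σ * q ≤ (q * l) * |∑ i, boolSign (σ i) * v i| := by
            have := mul_le_mul_of_nonneg_left hle (mul_nonneg hq0.le hl)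
            linarith
          rcases abs_cases (∑ i, boolSign (σ i) * v i) with ⟨h, _⟩ | ⟨h, _⟩
          · rw [h] at h5
            have := Real.exp_le_exp.2 h5
            rw [one_mul]
            linarith [Real.exp_pos (-1 * (q * l) * ∑ i, boolSign (σ i) * v i)]
          · rw [h] at h5
            have := Real.exp_le_exp.2 h5
            rw [show -1 * (q * l) * ∑ i, boolSign (σ i) * v i =
              q * l * -∑ i, boolSign (σ i) * v i by ring]
            linarith [Real.exp_pos (1 * (q * l) * ∑ i, boolSign (σ i) * v i)]
      _ = ∑ v ∈ J, (∑ σ : Fin n → Bool, Real.exp (1 * (q * l) * ∑ i, boolSign (σ i) * v i) +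
            ∑ σ : Fin n → Bool, Real.exp (-1 * (q * l) * ∑ i, boolSign (σ i) * v i)) := by
          rw [Finset.sum_comm]
          exact Finset.sum_congr rfl fun v _ => Finset.sum_add_distrib
      _ ≤ ∑ v ∈ J, (2 * (2 ^ n * Real.exp (q ^ 2 * (l ^ 2 * b ^ 2 / 2)))) := by
          refine Finset.sum_le_sum fun v hv => ?_
          linarith [hexp v hv 1 (by norm_num), hexp v hv (-1) (by norm_num)]
      _ = 2 ^ n * (2 * J.card) * Real.exp (q ^ 2 * (l ^ 2 * b ^ 2 / 2)) := by
          rw [Finset.sum_const, nsmul_eq_mul]; ring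
      _ ≤ 2 ^ n * 2 ^ q * Real.exp (q ^ 2 * (l ^ 2 * b ^ 2 / 2)) := by gcongr
      _ = _ := by
          rw [Real.mul_rpow (by norm_num) (Real.exp_pos _).le, ← Real.exp_mul, mul_assoc]
          congr 3
          ring
  have hjen := Real.rpow_arith_mean_le_arith_mean_rpow Finset.univ
    (fun _ : Fin n → Bool => ((2 : ℝ) ^ n)⁻¹) (fun σ => Real.exp (l * Y σ))
    (fun _ _ => by positivity) (by simp) (fun _ _ => (Real.exp_pos _).le) hq
  rw [← Finset.mul_sum, ← Finset.mul_sum] at hjen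
  have h6 : (((2 : ℝ) ^ n)⁻¹ * ∑ σ, Real.exp (l * Y σ)) ^ q ≤
      (2 * Real.exp (q * (l ^ 2 * b ^ 2 / 2))) ^ q := by
    refine hjen.trans ?_
    rw [inv_mul_le_iff₀ (by positivity)]
    exact hpow
  have h7 := (Real.rpow_le_rpow_iff (by positivity) (by positivity) hq0).1 h6
  rwa [inv_mul_le_iff₀ (by positivity)] at h7

/-- The constant in the sub-Gaussian chaining bound for entropy growth rate `p = 2 ^ s < 4`. -/
noncomputable def chainConst (c p : ℝ) : ℝ :=
  2 * (1 + 2 * c * p / Real.log 2) / (1 - Real.sqrt p / 2) ^ 2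

/-- Jensen's inequality with the missing mass 1 - ∑ a k placed at the point 0, where the exponential
is 1. The proof integrates the tangent line at the weighted mean. -/
theorem exp_weighted_sum_le {m : ℕ} (a x : ℕ → ℝ) (ha : ∀ k, 0 ≤ a k)
    (hsum : ∑ k ∈ Finset.range m, a k ≤ 1) :
    Real.exp (∑ k ∈ Finset.range m, a k * x k) ≤
      ∑ k ∈ Finset.range m, a k * Real.exp (x k) + (1 - ∑ k ∈ Finset.range m, a k) := by
  have key : ∀ y t : ℝ, Real.exp t + Real.exp t * (y - t) ≤ Real.exp y := by
    intro y t
    have h := Real.add_one_le_exp (y - t)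
    have h2 : Real.exp y = Real.exp t * Real.exp (y - t) := by rw [← Real.exp_add]; ring_nf
    rw [h2]
    nlinarith [Real.exp_pos t]
  obtain ⟨t, ht⟩ : ∃ t, t = ∑ k ∈ Finset.range m, a k * x k := ⟨_, rfl⟩
  rw [← ht]
  have h1 : ∑ k ∈ Finset.range m, a k * (Real.exp t + Real.exp t * (x k - t)) ≤
      ∑ k ∈ Finset.range m, a k * Real.exp (x k) :=
    Finset.sum_le_sum fun k _ => mul_le_mul_of_nonneg_left (key _ _) (ha k)
  have h2 : ∑ k ∈ Finset.range m, a k * (Real.exp t + Real.exp t * (x k - t)) =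
      (∑ k ∈ Finset.range m, a k) * (Real.exp t - Real.exp t * t) +
        Real.exp t * ∑ k ∈ Finset.range m, a k * x k := by
    generalize Real.exp t = e
    clear ht
    rw [Finset.sum_mul, Finset.mul_sum, ← Finset.sum_add_distrib]
    exact Finset.sum_congr rfl fun k _ => by ring
  rw [← ht] at h2
  have h3 := key 0 t
  rw [Real.exp_zero] at h3
  nlinarith

/-- Chaining bound for the moment generating function of a supremum of Rademacher sums. -/
theorem sum_exp_chaining_le {n : ℕ} {ι : Type*} (u : ι → EuclideanSpace ℝ (Fin n))
    (N : ℕ → Finset (EuclideanSpace ℝ (Fin n))) {b c p l : ℝ} (hb : 0 ≤ b) (hc : 0 < c)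
    (hp : 1 ≤ p) (hp4 : p < 4) (hl : 0 ≤ l) (h0 : N 0 = {0})
    (hcard : ∀ k, ((N k).card : ℝ) ≤ Real.exp (c * p ^ k))
    (hcov : ∀ k i, ∃ v ∈ N k, ‖u i - v‖ ≤ b * (1 / 2) ^ k)
    (Y : (Fin n → Bool) → ℝ) (hY : ∀ σ, ∃ i, Y σ ≤ |∑ j, boolSign (σ j) * u i j|) :
    ∑ σ, Real.exp (l * Y σ) ≤ 2 ^ n * (2 * Real.exp (l ^ 2 * b ^ 2 * chainConst c p)) := by
  classical
  have hι : Nonempty ι := ⟨(hY fun _ => true).choose⟩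
  choose v hvN hv using hcov
  have hlog : 0 < Real.log 2 := Real.log_pos (by norm_num)
  -- Level `k` will have at most exp(2cp · p^k) increments, so `D * p ^ k` is an admissible exponent
  -- `q` in `sum_exp_max_le`.
  set D : ℝ := 1 + 2 * c * p / Real.log 2 with hD
  have hD1 : 1 ≤ D := by
    have : 0 ≤ 2 * c * p / Real.log 2 := by positivity
    linarith
  -- The weights `a k` are proportional to √(p^k) · 2^(-k), the square root of the entropy times the
  -- scale. This makes the bound at level `k` independent of `k`. They are summable because p < 4,
  -- and κ = 1 - r normalizes their sum.
  set r : ℝ := Real.sqrt p / 2 with hr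
  have hr0 : 0 < r := by positivity
  have hr2 : r ^ 2 = p / 4 := by rw [hr, div_pow, Real.sq_sqrt (by linarith)]; norm_num
  have hr1 : r < 1 := by nlinarith
  set κ : ℝ := 1 - r with hκ
  have hκ0 : 0 < κ := by linarith
  set a : ℕ → ℝ := fun k => κ * r ^ k with ha
  have ha0 : ∀ k, 0 < a k := fun k => by positivity
  have hasum : ∀ m, ∑ k ∈ Finset.range m, a k ≤ 1 := by
    intro m
    rw [← Finset.mul_sum, hκ, mul_comm, geom_sum_mul_neg]
    linarith [pow_nonneg hr0.le m]
  set dot : (Fin n → Bool) → EuclideanSpace ℝ (Fin n) → ℝ :=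
    fun σ w => ∑ j, boolSign (σ j) * w j with hdot
  have dot_add : ∀ σ w w', dot σ (w + w') = dot σ w + dot σ w' := by
    intro σ w w'
    simp only [hdot, PiLp.add_apply, mul_add, Finset.sum_add_distrib]
  have dot_sub : ∀ σ w w', dot σ (w - w') = dot σ w - dot σ w' := by
    intro σ w w'
    simp only [hdot, PiLp.sub_apply, mul_sub, Finset.sum_sub_distrib]
  have dot_le : ∀ σ w, |dot σ w| ≤ n * ‖w‖ := by
    intro σ w
    refine (Finset.abs_sum_le_sum_abs _ _).trans ?_
    calc ∑ j, |boolSign (σ j) * w j| ≤ ∑ _j : Fin n, ‖w‖ := by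
          refine Finset.sum_le_sum fun j _ => ?_
          have h1 : |boolSign (σ j)| = 1 := by unfold boolSign; split_ifs <;> simp
          rw [abs_mul, h1, one_mul, ← Real.norm_eq_abs]
          exact PiLp.norm_apply_le w j
      _ = _ := by simp
  set J : ℕ → Finset (EuclideanSpace ℝ (Fin n)) := fun k =>
    ((N (k + 1) ×ˢ N k).image fun w => w.1 - w.2).filter fun w => ‖w‖ ≤ 2 * b * (1 / 2) ^ k
    with hJ
  have hincr : ∀ k i, v (k + 1) i - v k i ∈ J k := by
    intro k i
    simp only [hJ, Finset.mem_filter, Finset.mem_image, Finset.mem_product, Prod.exists]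
    refine ⟨⟨_, _, ⟨hvN (k + 1) i, hvN k i⟩, rfl⟩, ?_⟩
    have e : v (k + 1) i - v k i = (u i - v k i) - (u i - v (k + 1) i) := by abel
    rw [e]
    refine (norm_sub_le _ _).trans ?_
    have h1 := hv k i
    have h2 := hv (k + 1) i
    have h3 : 0 ≤ b * (1 / 2) ^ k := by positivity
    rw [pow_succ] at h2
    linarith
  have hJne : ∀ k, (J k).Nonempty := fun k => ⟨_, hincr k hι.some⟩
  -- At each level the link is replaced by the worst increment for the given signs, which no longer
  -- depends on the index `i`.
  have hmax : ∀ k σ, ∃ w ∈ J k, ∀ w' ∈ J k, |dot σ w'| ≤ |dot σ w| := fun k σ =>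
    Finset.exists_max_image (J k) (fun w => |dot σ w|) (hJne k)
  choose W hWJ hW using hmax
  have hlevel : ∀ k, ∑ σ, Real.exp (l / a k * |dot σ (W k σ)|) ≤
      2 ^ n * (2 * Real.exp (l ^ 2 * b ^ 2 * chainConst c p)) := by
    intro k
    have hpk : 1 ≤ p ^ k := one_le_pow₀ hp
    have hJc : 2 * ((J k).card : ℝ) ≤ 2 ^ (D * p ^ k) := by
      have h1 : ((J k).card : ℝ) ≤ (N (k + 1)).card * (N k).card := by
        rw [← Nat.cast_mul, ← Finset.card_product]
        exact_mod_cast (Finset.card_filter_le _ _).trans Finset.card_image_le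
      have h2 : ((J k).card : ℝ) ≤ Real.exp (c * p ^ (k + 1)) * Real.exp (c * p ^ k) :=
        h1.trans (mul_le_mul (hcard _) (hcard _) (by positivity) (by positivity))
      rw [← Real.exp_add] at h2
      rw [Real.rpow_def_of_pos (by norm_num)]
      calc 2 * ((J k).card : ℝ) ≤ Real.exp (Real.log 2) *
            Real.exp (c * p ^ (k + 1) + c * p ^ k) := by
            rw [Real.exp_log (by norm_num)]; gcongr
        _ ≤ _ := by
            rw [← Real.exp_add]
            refine Real.exp_le_exp.2 ?_
            have h3 : Real.log 2 * (D * p ^ k) = Real.log 2 * p ^ k + 2 * c * p * p ^ k := by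
              rw [hD]; field_simp
            rw [h3, pow_succ]
            have h4 : c * p ^ k ≤ c * p ^ k * p := le_mul_of_one_le_right (by positivity) hp
            nlinarith
    have := sum_exp_max_le (J k) (b := 2 * b * (1 / 2) ^ k) (q := D * p ^ k) (l := l / a k)
      (fun w hw => (Finset.mem_filter.1 hw).2) (by nlinarith) hJc
      (div_nonneg hl (ha0 k).le) (fun σ => |dot σ (W k σ)|) (fun σ => ⟨_, hWJ k σ, le_rfl⟩)
    refine this.trans (le_of_eq ?_)
    congr 3
    have e1 : (r ^ k) ^ 2 = p ^ k * ((1 / 2) ^ k) ^ 2 := by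
      rw [← pow_mul, mul_comm k 2, pow_mul, hr2, ← pow_mul, mul_comm k 2, pow_mul, ← mul_pow]
      congr 1; norm_num; ring
    have e2 : (a k) ^ 2 = κ ^ 2 * (p ^ k * ((1 / 2) ^ k) ^ 2) := by
      simp only [ha]; rw [mul_pow, e1]
    rw [div_pow, e2, chainConst]
    have : (0:ℝ) < (1/2) ^ k := by positivity
    have hp0 : 0 < p ^ k := by positivity
    change _ = l ^ 2 * b ^ 2 * (2 * D / κ ^ 2)
    generalize ((1:ℝ)/2)^k = y at *
    field_simp
  -- Stopping after `m` levels leaves a remainder of norm at most b · 2^(-m). It is bounded crudely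
  -- with a factor `n`, harmless because `n` is fixed while m → ∞.
  have hbound : ∀ m, ∑ σ, Real.exp (l * Y σ) ≤
      Real.exp (l * (n * (b * (1 / 2) ^ m))) *
        (2 ^ n * (2 * Real.exp (l ^ 2 * b ^ 2 * chainConst c p))) := by
    intro m
    have hpt : ∀ σ, Y σ ≤ n * (b * (1 / 2) ^ m) + ∑ k ∈ Finset.range m, |dot σ (W k σ)| := by
      intro σ
      obtain ⟨i, hi⟩ := hY σ
      have hv0 : v 0 i = 0 := by
        have := hvN 0 i
        rwa [h0, Finset.mem_singleton] at this
      have e : u i = (u i - v m i) + ∑ k ∈ Finset.range m, (v (k + 1) i - v k i) := by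
        rw [Finset.sum_range_sub (fun k => v k i), hv0]; abel
      have hsum : dot σ (∑ k ∈ Finset.range m, (v (k + 1) i - v k i)) =
          ∑ k ∈ Finset.range m, dot σ (v (k + 1) i - v k i) := by
        rw [Finset.sum_range_sub (fun k => v k i)]
        simp_rw [dot_sub]
        rw [Finset.sum_range_sub (fun k => dot σ (v k i))]
      refine hi.trans ?_
      change |dot σ (u i)| ≤ _
      rw [e, dot_add, hsum]
      refine (abs_add_le _ _).trans (add_le_add ?_ ?_)
      · exact (dot_le _ _).trans (by gcongr; exact hv m i)
      · refine (Finset.abs_sum_le_sum_abs _ _).trans ?_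
        exact Finset.sum_le_sum fun k _ => hW k σ _ (hincr k i)
    calc ∑ σ, Real.exp (l * Y σ)
        ≤ ∑ σ, Real.exp (l * (n * (b * (1 / 2) ^ m))) *
            Real.exp (∑ k ∈ Finset.range m, a k * (l / a k * |dot σ (W k σ)|)) := by
          refine Finset.sum_le_sum fun σ _ => ?_
          rw [← Real.exp_add]
          refine Real.exp_le_exp.2 ((mul_le_mul_of_nonneg_left (hpt σ) hl).trans (le_of_eq ?_))
          rw [mul_add, Finset.mul_sum]
          congr 1
          refine Finset.sum_congr rfl fun k _ => ?_
          have := (ha0 k).ne'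
          field_simp
      _ ≤ _ := by
          rw [← Finset.mul_sum]
          refine mul_le_mul_of_nonneg_left ?_ (Real.exp_pos _).le
          calc ∑ σ, Real.exp (∑ k ∈ Finset.range m, a k * (l / a k * |dot σ (W k σ)|))
              ≤ ∑ σ : Fin n → Bool, (∑ k ∈ Finset.range m,
                  a k * Real.exp (l / a k * |dot σ (W k σ)|) +
                    (1 - ∑ k ∈ Finset.range m, a k)) :=
                Finset.sum_le_sum fun σ _ =>
                  exp_weighted_sum_le a _ (fun k => (ha0 k).le) (hasum m)
            _ = ∑ k ∈ Finset.range m, a k * ∑ σ, Real.exp (l / a k * |dot σ (W k σ)|) +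
                  2 ^ n * (1 - ∑ k ∈ Finset.range m, a k) := by
                rw [Finset.sum_add_distrib, Finset.sum_comm]
                simp [Finset.mul_sum, mul_sub]
            _ ≤ ∑ k ∈ Finset.range m,
                  a k * (2 ^ n * (2 * Real.exp (l ^ 2 * b ^ 2 * chainConst c p))) +
                  (2 ^ n * (2 * Real.exp (l ^ 2 * b ^ 2 * chainConst c p))) *
                    (1 - ∑ k ∈ Finset.range m, a k) := by
                refine add_le_add (Finset.sum_le_sum fun k _ =>
                  mul_le_mul_of_nonneg_left (hlevel k) (ha0 k).le) ?_
                refine mul_le_mul_of_nonneg_right ?_ (by linarith [hasum m])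
                have hcc : 0 ≤ chainConst c p := by unfold chainConst; positivity
                have : 1 ≤ Real.exp (l ^ 2 * b ^ 2 * chainConst c p) :=
                  Real.one_le_exp (by positivity)
                have h2n : (0 : ℝ) < 2 ^ n := by positivity
                nlinarith
            _ = _ := by rw [← Finset.sum_mul]; ring
  have hlim : Tendsto (fun m : ℕ => Real.exp (l * (n * (b * (1 / 2) ^ m))) *
      (2 ^ n * (2 * Real.exp (l ^ 2 * b ^ 2 * chainConst c p)))) atTop
      (𝓝 (Real.exp (l * (n * (b * 0))) *
        (2 ^ n * (2 * Real.exp (l ^ 2 * b ^ 2 * chainConst c p))))) := by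
    refine Tendsto.mul_const _ ?_
    refine (Real.continuous_exp.tendsto _).comp ?_
    refine Tendsto.const_mul _ (Tendsto.const_mul _ (Tendsto.const_mul _ ?_))
    exact tendsto_pow_atTop_nhds_zero_of_lt_one (by norm_num) (by norm_num)
  simp only [mul_zero, Real.exp_zero, one_mul] at hlim
  exact ge_of_tendsto' hlim hbound

end MEE

/-! ### Symmetrization and entropy of the hypothesis space -/

namespace MEE

theorem le_iSup_of_finite {ι : Type*} [Finite ι] (f : ι → ℝ) (i : ι) : f i ≤ ⨆ i, f i :=
  le_ciSup (Set.finite_range f).bddAbove i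

theorem exists_eq_iSup_abs {ι : Type*} [Finite ι] [Nonempty ι] (f : ι → ℝ) :
    ∃ i, ⨆ i, |f i| ≤ |f i| := by
  obtain ⟨i, hi⟩ := Finite.exists_max fun i => |f i|
  exact ⟨i, ciSup_le hi⟩

/-- Exponential symmetrization: the moment generating function of the uniform deviation of an
empirical process is controlled by conditional Rademacher averages. -/
theorem integral_exp_iSup_deviation_le {Z ι : Type*} [MeasurableSpace Z] (ρ : Measure Z)
    [IsProbabilityMeasure ρ] [Finite ι] [Nonempty ι] {n : ℕ} (φ : ι → Z → ℝ)
    (hφ : ∀ i, Measurable (φ i)) (hφ1 : ∀ i z, |φ i z| ≤ 1) {l B : ℝ} (hl : 0 ≤ l)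
    (hB : ∀ w : Fin n → Z × Z, ∑ σ : Fin n → Bool, Real.exp (l * ⨆ i,
      |∑ j, boolSign (σ j) * (φ i (w j).1 - φ i (w j).2)|) ≤ 2 ^ n * B) :
    ∫ z : Fin n → Z, Real.exp (l * ⨆ i, |∑ j, φ i (z j) - n * ∫ y, φ i y ∂ρ|)
      ∂(Measure.pi fun _ => ρ) ≤ B := by
  set P := Measure.pi fun _ : Fin n => ρ
  set G : (Fin n → Z × Z) → ℝ := fun w =>
    Real.exp (l * ⨆ i, |∑ j, (φ i (w j).1 - φ i (w j).2)|) with hG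
  have hGm : Measurable G := by
    refine (((Measurable.iSup fun i => ?_).const_mul l)).exp
    have := hφ i
    fun_prop
  have hterm : ∀ i (w : Fin n → Z × Z) (σ : Fin n → Bool),
      |∑ j, boolSign (σ j) * (φ i (w j).1 - φ i (w j).2)| ≤ n * 2 := by
    intro i w σ
    refine (Finset.abs_sum_le_sum_abs _ _).trans ?_
    refine (Finset.sum_le_sum (g := fun _ => (2 : ℝ)) fun j _ => ?_).trans (by simp)
    have h1 : |boolSign (σ j)| = 1 := by unfold boolSign; split_ifs <;> simp
    rw [abs_mul, h1, one_mul]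
    have := abs_le.1 (hφ1 i (w j).1)
    have := abs_le.1 (hφ1 i (w j).2)
    rw [abs_le]; constructor <;> linarith
  have hGb : ∀ w, ‖G w‖ ≤ Real.exp (l * (n * 2)) := by
    intro w
    rw [Real.norm_eq_abs, abs_of_pos (Real.exp_pos _)]
    refine Real.exp_le_exp.2 (mul_le_mul_of_nonneg_left (ciSup_le fun i => ?_) hl)
    have := hterm i w fun _ => true
    simpa [boolSign] using this
  have hint : ∀ i, Integrable (φ i) ρ := fun i =>
    Integrable.of_bound (hφ i).aestronglyMeasurable 1 (ae_of_all _ (hφ1 i))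
  set e := MeasurableEquiv.arrowProdEquivProdArrow Z Z (Fin n)
  have hmp : MeasurePreserving e (Measure.pi fun _ => ρ.prod ρ) (P.prod P) :=
    measurePreserving_arrowProdEquivProdArrow Z Z (Fin n) (fun _ => ρ) (fun _ => ρ)
  set F : (Fin n → Z) × (Fin n → Z) → ℝ := fun q => G (e.symm q) with hF
  have hFint : Integrable F (P.prod P) :=
    Integrable.of_bound (hGm.comp e.symm.measurable).aestronglyMeasurable _
      (ae_of_all _ fun q => hGb _)
  -- The true mean is the expectation over an independent ghost sample z'. Jensen is used twice,
  -- first for the supremum and then for the exponential.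
  have hjensen : ∀ z, Real.exp (l * ⨆ i, |∑ j, φ i (z j) - n * ∫ y, φ i y ∂ρ|) ≤
      ∫ z', F (z, z') ∂P := by
    intro z
    have hM : Measurable fun z' : Fin n → Z => ⨆ i, |∑ j, (φ i (z j) - φ i (z' j))| := by
      refine Measurable.iSup fun i => ?_
      have := hφ i
      fun_prop
    have hMb : ∀ z' : Fin n → Z, ‖⨆ i, |∑ j, (φ i (z j) - φ i (z' j))|‖ ≤ n * 2 := by
      intro z'
      rw [Real.norm_eq_abs, abs_of_nonneg (Real.iSup_nonneg fun i => abs_nonneg _)]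
      refine ciSup_le fun i => ?_
      have := hterm i (fun j => (z j, z' j)) fun _ => true
      simpa [boolSign] using this
    have hMint : Integrable (fun z' : Fin n → Z => ⨆ i, |∑ j, (φ i (z j) - φ i (z' j))|) P :=
      Integrable.of_bound hM.aestronglyMeasurable _ (ae_of_all _ hMb)
    have h1 : (⨆ i, |∑ j, φ i (z j) - n * ∫ y, φ i y ∂ρ|) ≤
        ∫ z', ⨆ i, |∑ j, (φ i (z j) - φ i (z' j))| ∂P := by
      refine ciSup_le fun i => ?_
      have hcoord : ∀ j, Integrable (fun z' : Fin n → Z => φ i (z' j)) P := fun j =>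
        integrable_comp_eval (hint i)
      have h2 : ∫ z', ∑ j, (φ i (z j) - φ i (z' j)) ∂P =
          ∑ j, φ i (z j) - n * ∫ y, φ i y ∂ρ := by
        have hI : ∀ j, Integrable (fun z' : Fin n → Z => φ i (z j) - φ i (z' j)) P := fun j =>
          (integrable_const _).sub (hcoord j)
        rw [integral_finsetSum _ fun j _ => hI j]
        have : ∀ j, ∫ z', (φ i (z j) - φ i (z' j)) ∂P = φ i (z j) - ∫ y, φ i y ∂ρ := by
          intro j
          rw [integral_sub (integrable_const _) (hcoord j), integral_const,
            integral_comp_eval (hφ i).aestronglyMeasurable]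
          simp
        simp_rw [this]
        simp
      rw [← h2]
      refine (abs_integral_le_integral_abs).trans ?_
      refine integral_mono_of_nonneg (ae_of_all _ fun _ => abs_nonneg _) hMint
        (ae_of_all _ fun z' => ?_)
      exact le_iSup_of_finite (fun i => |∑ j, (φ i (z j) - φ i (z' j))|) i
    refine (Real.exp_le_exp.2 (mul_le_mul_of_nonneg_left h1 hl)).trans ?_
    rw [← integral_const_mul]
    refine convexOn_exp.map_integral_le Real.continuous_exp.continuousOn isClosed_univ
      (by simp) (hMint.const_mul l) ?_
    refine Integrable.of_bound (C := Real.exp (l * (n * 2)))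
      ((hM.const_mul l).exp).aestronglyMeasurable (ae_of_all _ fun z' => ?_)
    exact hGb fun j => (z j, z' j)
  have hswap : ∀ σ : Fin n → Bool, ∫ w, G w ∂(Measure.pi fun _ => ρ.prod ρ) =
      ∫ w : Fin n → Z × Z, Real.exp (l * ⨆ i,
        |∑ j, boolSign (σ j) * (φ i (w j).1 - φ i (w j).2)|)
        ∂(Measure.pi fun _ => ρ.prod ρ) := by
    -- Exchanging the two points of the j-th pair whenever `σ j` is false preserves the product law
    -- and flips the sign of the j-th difference.
    intro σ
    have hT : MeasurePreserving
        (fun (w : Fin n → Z × Z) j => (if σ j then id else Prod.swap) (w j))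
        (Measure.pi fun _ => ρ.prod ρ) (Measure.pi fun _ => ρ.prod ρ) := by
      refine measurePreserving_pi (fun _ => ρ.prod ρ) (fun _ => ρ.prod ρ)
        (f := fun j => (if σ j then id else Prod.swap : Z × Z → Z × Z)) fun j => ?_
      by_cases h : σ j
      · simpa [h] using MeasurePreserving.id (ρ.prod ρ)
      · simpa [h] using Measure.measurePreserving_swap (μ := ρ) (ν := ρ)
    rw [← hT.map_eq, integral_map hT.measurable.aemeasurable
      hGm.aestronglyMeasurable, hT.map_eq]
    refine integral_congr_ae (ae_of_all _ fun w => ?_)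
    simp only [hG]
    congr 3
    ext i
    congr 2
    ext j
    by_cases h : σ j <;> simp [h, boolSign]
  calc ∫ z : Fin n → Z, Real.exp (l * ⨆ i, |∑ j, φ i (z j) - n * ∫ y, φ i y ∂ρ|) ∂P
      ≤ ∫ z, ∫ z', F (z, z') ∂P ∂P :=
        integral_mono_of_nonneg (ae_of_all _ fun _ => (Real.exp_pos _).le)
          hFint.integral_prod_left (ae_of_all _ hjensen)
    _ = ∫ q, F q ∂(P.prod P) := (integral_prod _ hFint).symm
    _ = ∫ w, G w ∂(Measure.pi fun _ => ρ.prod ρ) := by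
        rw [← hmp.map_eq, integral_map_equiv]
        simp [hF]
    _ ≤ B := by
        have hI : ∀ σ : Fin n → Bool, Integrable (fun w : Fin n → Z × Z => Real.exp (l * ⨆ i,
            |∑ j, boolSign (σ j) * (φ i (w j).1 - φ i (w j).2)|))
            (Measure.pi fun _ => ρ.prod ρ) := by
          intro σ
          refine Integrable.of_bound (C := Real.exp (l * (n * 2)))
            ?_ (ae_of_all _ fun w => ?_)
          · refine (((Measurable.iSup fun i => ?_).const_mul l)).exp.aestronglyMeasurable
            have := hφ i
            fun_prop
          · rw [Real.norm_eq_abs, abs_of_pos (Real.exp_pos _)]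
            exact Real.exp_le_exp.2 (mul_le_mul_of_nonneg_left
              (ciSup_le fun i => hterm i w σ) hl)
        -- All 2^n sign patterns give the same integral, so it may be replaced by their average, to
        -- which `hB` applies pointwise.
        have h1 : (2 : ℝ) ^ n * ∫ w, G w ∂(Measure.pi fun _ => ρ.prod ρ) ≤ 2 ^ n * B := by
          calc (2 : ℝ) ^ n * ∫ w, G w ∂(Measure.pi fun _ => ρ.prod ρ)
              = ∑ _σ : Fin n → Bool, ∫ w, G w ∂(Measure.pi fun _ => ρ.prod ρ) := by simp
            _ = ∫ w, ∑ σ : Fin n → Bool, Real.exp (l * ⨆ i,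
                  |∑ j, boolSign (σ j) * (φ i (w j).1 - φ i (w j).2)|)
                  ∂(Measure.pi fun _ => ρ.prod ρ) := by
                rw [integral_finsetSum _ fun σ _ => hI σ]
                exact Finset.sum_congr rfl fun σ _ => hswap σ
            _ ≤ ∫ _w, 2 ^ n * B ∂(Measure.pi fun _ => ρ.prod ρ) :=
                integral_mono (integrable_finsetSum _ fun σ _ => hI σ) (integrable_const _) hB
            _ = _ := by simp
        exact le_of_mul_le_mul_left h1 (by positivity)

/-- Finite covers of the restrictions of a class with entropy bound `c ε ^ (-s)`. -/
theorem exists_finset_cover {X : Type*} {H : Set (X → ℝ)} {c s : ℝ}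
    (hcov : ∀ ε : ℝ≥0, 0 < ε →
      ENNReal.log (empiricalCoveringNumber H ε : ℝ≥0∞) ≤ ((c * (ε : ℝ) ^ (-s) : ℝ) : EReal))
    {m : ℕ} (x : Fin m → X) (ε : ℝ≥0) (hε : 0 < ε) :
    ∃ N : Finset (EuclideanSpace ℝ (Fin m)), (N.card : ℝ) ≤ Real.exp (c * (ε : ℝ) ^ (-s)) ∧
      ∀ f ∈ H, ∃ v ∈ N,
        ‖(WithLp.toLp 2 (fun i => f (x i)) : EuclideanSpace ℝ (Fin m)) - v‖ ≤ ε * √m := by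
  set S : Set (EuclideanSpace ℝ (Fin m)) :=
    (fun f : X → ℝ => (WithLp.toLp 2 (fun i => f (x i)) : EuclideanSpace ℝ (Fin m))) '' H
  set r : ℝ≥0 := ε * NNReal.sqrt (m : ℝ≥0) with hr
  have hle : Metric.externalCoveringNumber r S ≤ empiricalCoveringNumber H ε :=
    le_iSup_of_le m (le_iSup_of_le x le_rfl)
  have hexp : ((Metric.externalCoveringNumber r S : ℕ∞) : ℝ≥0∞) ≤
      ENNReal.ofReal (Real.exp (c * (ε : ℝ) ^ (-s))) := by
    refine (ENat.toENNReal_mono hle).trans ?_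
    rw [← ENNReal.log_le_log_iff, ENNReal.log_ofReal_of_pos (Real.exp_pos _), Real.log_exp]
    exact hcov ε hε
  have hne : Metric.externalCoveringNumber r S ≠ ⊤ := by
    intro h
    rw [h] at hexp
    simp at hexp
  have : ∃ N : Set (EuclideanSpace ℝ (Fin m)), Metric.IsCover r S N ∧
      N.encard = Metric.externalCoveringNumber r S := by
    have : Nonempty {N : Set (EuclideanSpace ℝ (Fin m)) // Metric.IsCover r S N} :=
      ⟨⟨S, Metric.IsCover.rfl⟩⟩
    obtain ⟨N, hN⟩ := ciInf_mem
      fun N : {N : Set (EuclideanSpace ℝ (Fin m)) // Metric.IsCover r S N} => N.1.encard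
    exact ⟨N.1, N.2, hN.trans (by rw [Metric.externalCoveringNumber, iInf_subtype'])⟩
  obtain ⟨N, hN, hNc⟩ := this
  have hfin : N.Finite := Set.encard_ne_top_iff.1 (hNc ▸ hne)
  refine ⟨hfin.toFinset, ?_, fun f hf => ?_⟩
  · rw [← hNc, hfin.encard_eq_coe_toFinset_card] at hexp
    have := (ENNReal.toReal_le_toReal (by simp) ENNReal.ofReal_ne_top).2 hexp
    rw [ENNReal.toReal_ofReal (Real.exp_pos _).le] at this
    simpa using this
  · obtain ⟨v, hv, hd⟩ := hN (Set.mem_image_of_mem _ hf)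
    refine ⟨v, hfin.mem_toFinset.2 hv, ?_⟩
    have h1 : edist (WithLp.toLp 2 (fun i => f (x i)) : EuclideanSpace ℝ (Fin m)) v ≤ r := hd
    rw [edist_nndist, ENNReal.coe_le_coe, ← NNReal.coe_le_coe, coe_nndist, dist_eq_norm] at h1
    simpa [hr] using h1

/-- Conditional Rademacher averages of a Lipschitz image of a class with small entropy. -/
theorem sum_exp_rademacher_le {X Z ι : Type*} {H : Set (X → ℝ)} {c s : ℝ} (hc : 0 < c)
    (hs : 0 < s) (hs2 : s < 2) (hcov : ∀ ε : ℝ≥0, 0 < ε →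
      ENNReal.log (empiricalCoveringNumber H ε : ℝ≥0∞) ≤ ((c * (ε : ℝ) ^ (-s) : ℝ) : EReal))
    [Finite ι] [Nonempty ι] (g : ι → X → ℝ) (hg : ∀ i, g i ∈ H) (π : Z → X)
    (ψ : Z → ℝ → ℝ) (hψ1 : ∀ z t, |ψ z t| ≤ 1)
    (hψ : ∀ z t t', |ψ z t - ψ z t'| ≤ |t - t'|) {n : ℕ} (w : Fin n → Z × Z) {l : ℝ}
    (hl : 0 ≤ l) :
    ∑ σ : Fin n → Bool, Real.exp (l * ⨆ i, |∑ j, boolSign (σ j) *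
      (ψ (w j).1 (g i (π (w j).1)) - ψ (w j).2 (g i (π (w j).2)))|) ≤
      2 ^ n * (2 * Real.exp (l ^ 2 * (4 * n) * chainConst c (2 ^ s))) := by
  classical
  -- Sample and ghost sample are concatenated, so that one cover in dimension 2n controls both.
  set x : Fin (n + n) → X := Fin.append (fun j => π (w j).1) (fun j => π (w j).2) with hx
  have hcover := fun k : ℕ => exists_finset_cover hcov x ((1 / 2) ^ k) (by positivity)
  choose N hNcard hNcov using hcover
  set T : EuclideanSpace ℝ (Fin (n + n)) → EuclideanSpace ℝ (Fin n) := fun v =>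
    WithLp.toLp 2 fun j => ψ (w j).1 (v (Fin.castAdd n j)) - ψ (w j).2 (v (Fin.natAdd n j))
    with hT
  -- `T` is √2-Lipschitz by (a - b)² ≤ 2a² + 2b². A cover of radius ε√(2n) is thus mapped to one of
  -- radius 2ε√n, which explains the scale `b = 2 * √n` below.
  have hTle : ∀ v v', ‖T v - T v'‖ ^ 2 ≤ 2 * ‖v - v'‖ ^ 2 := by
    intro v v'
    rw [EuclideanSpace.real_norm_sq_eq, EuclideanSpace.real_norm_sq_eq, Fin.sum_univ_add,
      ← Finset.sum_add_distrib, Finset.mul_sum]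
    refine Finset.sum_le_sum fun j _ => ?_
    simp only [hT, PiLp.sub_apply]
    have h1 := sq_le_sq.2 (hψ (w j).1 (v (Fin.castAdd n j)) (v' (Fin.castAdd n j)))
    have h2 := sq_le_sq.2 (hψ (w j).2 (v (Fin.natAdd n j)) (v' (Fin.natAdd n j)))
    nlinarith [sq_nonneg ((ψ (w j).1 (v (Fin.castAdd n j)) - ψ (w j).1 (v' (Fin.castAdd n j))) +
      (ψ (w j).2 (v (Fin.natAdd n j)) - ψ (w j).2 (v' (Fin.natAdd n j))))]
  set u : ι → EuclideanSpace ℝ (Fin n) := fun i => T (WithLp.toLp 2 fun j => g i (x j)) with hu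
  have huapp : ∀ i j, u i j =
      ψ (w j).1 (g i (π (w j).1)) - ψ (w j).2 (g i (π (w j).2)) := by
    intro i j
    simp only [hu, hT, hx, Fin.append_left, Fin.append_right]
  have hp1 : (1 : ℝ) ≤ 2 ^ s := Real.one_le_rpow (by norm_num) hs.le
  have hp4 : (2 : ℝ) ^ s < 4 := by
    calc (2 : ℝ) ^ s < 2 ^ (2 : ℝ) := Real.rpow_lt_rpow_of_exponent_lt (by norm_num) hs2
      _ = 4 := by norm_num
  -- The level-0 net may be {0}: every coordinate of `u i` is at most 2 in absolute value, so its
  -- norm is at most 2√n.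
  have hmain := sum_exp_chaining_le u (fun k => if k = 0 then {0} else (N k).image T)
    (b := 2 * √n) (c := c) (p := 2 ^ s) (l := l) (by positivity) hc hp1 hp4 hl (by simp)
    ?_ ?_ (fun σ => ⨆ i, |∑ j, boolSign (σ j) * u i j|) (fun σ => exists_eq_iSup_abs _)
  · simp_rw [huapp] at hmain
    have e : l ^ 2 * (2 * √(n : ℝ)) ^ 2 = l ^ 2 * (4 * n) := by
      rw [mul_pow, Real.sq_sqrt (by positivity)]; norm_num
    rwa [e] at hmain
  · intro k
    by_cases hk : k = 0
    · simp only [hk, if_true, Finset.card_singleton, Nat.cast_one]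
      exact Real.one_le_exp (by positivity)
    · simp only [hk, if_false]
      refine (Nat.cast_le.2 Finset.card_image_le).trans ((hNcard k).trans (le_of_eq ?_))
      congr 2
      push_cast
      rw [← Real.rpow_natCast, ← Real.rpow_mul (by norm_num), ← Real.rpow_natCast,
        ← Real.rpow_mul (by norm_num), one_div, Real.inv_rpow (by norm_num),
        ← Real.rpow_neg (by norm_num)]
      congr 1; ring
  · intro k i
    by_cases hk : k = 0
    · simp only [hk, if_true, Finset.mem_singleton, exists_eq_left, sub_zero, pow_zero, mul_one]
      refine abs_le_of_sq_le_sq' ?_ (by positivity) |>.2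
      rw [mul_pow, Real.sq_sqrt (by positivity), EuclideanSpace.real_norm_sq_eq]
      refine (Finset.sum_le_sum (g := fun _ => (4 : ℝ)) fun j _ => ?_).trans
        (by simp [mul_comm]; norm_num)
      rw [huapp]
      have h1 := abs_le.1 (hψ1 (w j).1 (g i (π (w j).1)))
      have h2 := abs_le.1 (hψ1 (w j).2 (g i (π (w j).2)))
      nlinarith
    · simp only [hk, if_false]
      obtain ⟨v, hv, hd⟩ := hNcov k (g i) (hg i)
      refine ⟨T v, Finset.mem_image_of_mem _ hv, ?_⟩
      refine abs_le_of_sq_le_sq' ?_ (by positivity) |>.2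
      refine (hTle _ _).trans ?_
      have h1 : ‖(WithLp.toLp 2 fun j => g i (x j) : EuclideanSpace ℝ (Fin (n + n))) - v‖ ^ 2 ≤
        (((1 / 2) ^ k : ℝ≥0) * √((n + n : ℕ) : ℝ)) ^ 2 := by gcongr
      refine (mul_le_mul_of_nonneg_left h1 (by norm_num)).trans (le_of_eq ?_)
      rw [mul_pow, mul_pow, mul_pow, Real.sq_sqrt (by positivity), Real.sq_sqrt (by positivity)]
      push_cast
      ring

end MEE

/-! ### Spectral form of the potentials and deviation bounds for finite families -/

namespace MEE

/-- The Hartley kernel `cos + sin`. -/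
noncomputable def cas (t : ℝ) : ℝ := Real.cos t + Real.sin t

theorem continuous_cas : Continuous cas := Real.continuous_cos.add Real.continuous_sin

@[fun_prop]
theorem measurable_cas : Measurable cas := continuous_cas.measurable

theorem abs_cas_le (t : ℝ) : |cas t| ≤ 2 := by
  have h1 := abs_le.1 (Real.abs_cos_le_one t)
  have h2 := abs_le.1 (Real.abs_sin_le_one t)
  unfold cas
  rw [abs_le]; constructor <;> linarith

theorem abs_cas_sub_le (t t' : ℝ) : |cas t - cas t'| ≤ 2 * |t - t'| := by
  have h1 : |Real.cos t - Real.cos t'| ≤ |t - t'| := by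
    simpa [Real.dist_eq] using Real.lipschitzWith_cos.dist_le_mul t t'
  have h2 : |Real.sin t - Real.sin t'| ≤ |t - t'| := by
    simpa [Real.dist_eq] using Real.lipschitzWith_sin.dist_le_mul t t'
  unfold cas
  have e : Real.cos t + Real.sin t - (Real.cos t' + Real.sin t') =
    (Real.cos t - Real.cos t') + (Real.sin t - Real.sin t') := by ring
  rw [e]
  linarith [abs_add_le (Real.cos t - Real.cos t') (Real.sin t - Real.sin t')]

/-- The term in s + t averages to zero over a symmetric frequency law. What survives is the kernel,
written as an average of products of one real function of each variable. -/
theorem cas_mul_cas (s t : ℝ) : cas s * cas t = Real.cos (s - t) + Real.sin (s + t) := by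
  unfold cas
  rw [Real.cos_sub, Real.sin_add]
  ring

/-- The spectral probability measure of the Gaussian kernel of bandwidth `h`. -/
noncomputable def freqLaw (h : ℝ) : Measure ℝ :=
  ProbabilityTheory.gaussianReal 0 (Real.toNNReal (1 / h ^ 2))

instance (h : ℝ) : IsProbabilityMeasure (freqLaw h) := by unfold freqLaw; infer_instance

/-- The value `G_h(0)`. -/
noncomputable def kernelScale (h : ℝ) : ℝ := 1 / (Real.sqrt (2 * Real.pi) * h)

theorem kernelScale_pos {h : ℝ} (hh : 0 < h) : 0 < kernelScale h := by
  unfold kernelScale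
  have := Real.pi_pos
  positivity

theorem integrable_of_abs_le {Z : Type*} [MeasurableSpace Z] {μ : Measure Z} [IsFiniteMeasure μ]
    {f : Z → ℝ} (hf : Measurable f) {C : ℝ} (h : ∀ z, |f z| ≤ C) : Integrable f μ :=
  Integrable.of_bound hf.aestronglyMeasurable C (ae_of_all _ h)

theorem abs_integral_le_of_abs_le {Z : Type*} [MeasurableSpace Z] {μ : Measure Z}
    [IsProbabilityMeasure μ] {f : Z → ℝ} {C : ℝ} (h : ∀ z, |f z| ≤ C) :
    |∫ z, f z ∂μ| ≤ C := by
  have := norm_integral_le_of_norm_le_const (μ := μ) (f := f) (ae_of_all _ h)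
  simpa using this

theorem integral_cexp_freqLaw (h t : ℝ) :
    ∫ ξ, Complex.exp (t * ξ * Complex.I) ∂(freqLaw h) =
      (Real.exp (-t ^ 2 / (2 * h ^ 2)) : ℝ) := by
  rw [← charFun_apply_real, freqLaw, ProbabilityTheory.charFun_gaussianReal,
    Real.coe_toNNReal _ (by positivity)]
  push_cast
  congr 1
  simp
  ring

theorem integrable_cexp_freqLaw (h t : ℝ) :
    Integrable (fun ξ : ℝ => Complex.exp (t * ξ * Complex.I)) (freqLaw h) := by
  refine Integrable.of_bound (C := 1) (by fun_prop) (ae_of_all _ fun ξ => ?_)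
  rw [← Complex.ofReal_mul, Complex.norm_exp_ofReal_mul_I]

theorem integral_cos_freqLaw (h t : ℝ) :
    ∫ ξ, Real.cos (ξ * t) ∂(freqLaw h) = Real.exp (-t ^ 2 / (2 * h ^ 2)) := by
  have h1 := congrArg Complex.re (integral_cexp_freqLaw h t)
  rw [Complex.ofReal_re] at h1
  rw [← h1]
  have := integral_re (𝕜 := ℂ) (integrable_cexp_freqLaw h t)
  refine Eq.trans ?_ this
  refine integral_congr_ae (ae_of_all _ fun ξ => ?_)
  simp only [← Complex.ofReal_mul, RCLike.re_to_complex, Complex.exp_ofReal_mul_I_re]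
  rw [mul_comm]

theorem integral_sin_freqLaw (h t : ℝ) : ∫ ξ, Real.sin (ξ * t) ∂(freqLaw h) = 0 := by
  have h1 := congrArg Complex.im (integral_cexp_freqLaw h t)
  rw [Complex.ofReal_im] at h1
  rw [← h1]
  have := integral_im (𝕜 := ℂ) (integrable_cexp_freqLaw h t)
  refine Eq.trans ?_ this
  refine integral_congr_ae (ae_of_all _ fun ξ => ?_)
  simp only [← Complex.ofReal_mul, RCLike.im_to_complex, Complex.exp_ofReal_mul_I_im]
  rw [mul_comm]

theorem gaussKernel_eq_integral_cos (h t : ℝ) :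
    gaussKernel h t = kernelScale h * ∫ ξ, Real.cos (ξ * t) ∂(freqLaw h) := by
  rw [integral_cos_freqLaw]; rfl

theorem gaussKernel_sub_eq_integral_cas (h s t : ℝ) :
    gaussKernel h (s - t) = kernelScale h * ∫ ξ, cas (ξ * s) * cas (ξ * t) ∂(freqLaw h) := by
  have h1 : ∀ ξ, cas (ξ * s) * cas (ξ * t) = Real.cos (ξ * (s - t)) + Real.sin (ξ * (s + t)) := by
    intro ξ
    rw [cas_mul_cas, mul_sub, mul_add]
  simp_rw [h1]
  rw [integral_add, integral_sin_freqLaw, add_zero, gaussKernel_eq_integral_cos]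
  · exact integrable_of_abs_le (by fun_prop) fun ξ => Real.abs_cos_le_one _
  · exact integrable_of_abs_le (by fun_prop) fun ξ => Real.abs_sin_le_one _

theorem integral_integral_integral_rotate {Z : Type*} [MeasurableSpace Z] (Q : Measure Z)
    [IsProbabilityMeasure Q] (γ : Measure ℝ) [IsProbabilityMeasure γ] (K : ℝ → Z → Z → ℝ)
    (hK : Measurable fun q : ℝ × Z × Z => K q.1 q.2.1 q.2.2) {C : ℝ}
    (hC : ∀ ξ z z', |K ξ z z'| ≤ C) :
    ∫ z, ∫ z', ∫ ξ, K ξ z z' ∂γ ∂Q ∂Q = ∫ ξ, ∫ z, ∫ z', K ξ z z' ∂Q ∂Q ∂γ := by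
  have h1 : ∀ z, ∫ z', ∫ ξ, K ξ z z' ∂γ ∂Q = ∫ ξ, ∫ z', K ξ z z' ∂Q ∂γ := fun z =>
    integral_integral_swap (f := fun z' ξ => K ξ z z') (integrable_of_abs_le (C := C)
      (hK.comp (measurable_snd.prodMk (measurable_const.prodMk measurable_fst)))
      fun q => hC _ _ _)
  simp_rw [h1]
  refine integral_integral_swap (f := fun z ξ => ∫ z', K ξ z z' ∂Q)
    (integrable_of_abs_le (C := C) ?_ fun q => abs_integral_le_of_abs_le fun z' => hC _ _ _)
  have : StronglyMeasurable (Function.uncurry fun (q : Z × ℝ) (z' : Z) => K q.2 q.1 z') :=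
    (hK.comp ((measurable_snd.comp measurable_fst).prodMk
      ((measurable_fst.comp measurable_fst).prodMk measurable_snd))).stronglyMeasurable
  exact this.integral_prod_right.measurable

section Potential

variable {X : Type*} [MeasurableSpace X]

theorem informationError_eq_cos (ρ : Measure (X × ℝ)) [IsProbabilityMeasure ρ] (h : ℝ)
    {f : X → ℝ} (hf : Measurable f) :
    informationError ρ h f = -(kernelScale h * ∫ ξ, ∫ z, ∫ z',
      Real.cos (ξ * ((z.2 - f z.1) - (z'.2 - f z'.1))) ∂ρ ∂ρ ∂(freqLaw h)) := by
  unfold informationError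
  simp_rw [gaussKernel_eq_integral_cos, integral_const_mul]
  rw [integral_integral_integral_rotate ρ (freqLaw h)
    (fun ξ z z' => Real.cos (ξ * ((z.2 - f z.1) - (z'.2 - f z'.1)))) (by fun_prop)
    (fun _ _ _ => Real.abs_cos_le_one _)]

/-- This form involves the square of a single real mean per frequency and serves the empirical
comparison. The cosine form leads to the modulus of the characteristic function and serves the
population comparison. -/
theorem informationError_eq_cas (ρ : Measure (X × ℝ)) [IsProbabilityMeasure ρ] (h : ℝ)
    {f : X → ℝ} (hf : Measurable f) :
    informationError ρ h f = -(kernelScale h *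
      ∫ ξ, (∫ z, cas (ξ * (z.2 - f z.1)) ∂ρ) ^ 2 ∂(freqLaw h)) := by
  unfold informationError
  simp_rw [gaussKernel_sub_eq_integral_cas, integral_const_mul]
  rw [integral_integral_integral_rotate ρ (freqLaw h)
    (fun ξ z z' => cas (ξ * (z.2 - f z.1)) * cas (ξ * (z'.2 - f z'.1))) (C := 4) (by fun_prop)]
  · simp_rw [integral_const_mul, integral_mul_const, sq]
  · intro ξ z z'
    rw [abs_mul]
    nlinarith [abs_cas_le (ξ * (z.2 - f z.1)), abs_cas_le (ξ * (z'.2 - f z'.1)),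
      abs_nonneg (cas (ξ * (z.2 - f z.1))), abs_nonneg (cas (ξ * (z'.2 - f z'.1)))]

end Potential

/-- The empirical information potential `n⁻² ∑ G_h(e_i - e_j)`. -/
noncomputable def empiricalPotential {X : Type*} {n : ℕ} (h : ℝ) (z : Fin n → X × ℝ) (f : X → ℝ) : ℝ :=
  1 / (n : ℝ) ^ 2 * ∑ i, ∑ j, gaussKernel h (((z i).2 - f (z i).1) - ((z j).2 - f (z j).1))

theorem empiricalPotential_eq_cas {X : Type*} {n : ℕ} (h : ℝ) (z : Fin n → X × ℝ) (f : X → ℝ) :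
    empiricalPotential h z f = kernelScale h *
      ∫ ξ, ((∑ j, cas (ξ * ((z j).2 - f (z j).1))) / n) ^ 2 ∂(freqLaw h) := by
  have hint : ∀ i j, Integrable (fun ξ => cas (ξ * ((z i).2 - f (z i).1)) *
      cas (ξ * ((z j).2 - f (z j).1))) (freqLaw h) := by
    intro i j
    refine integrable_of_abs_le (C := 4) (by fun_prop) fun ξ => ?_
    rw [abs_mul]
    nlinarith [abs_cas_le (ξ * ((z i).2 - f (z i).1)), abs_cas_le (ξ * ((z j).2 - f (z j).1)),
      abs_nonneg (cas (ξ * ((z i).2 - f (z i).1))), abs_nonneg (cas (ξ * ((z j).2 - f (z j).1)))]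
  unfold empiricalPotential
  simp_rw [gaussKernel_sub_eq_integral_cas, ← Finset.mul_sum, div_pow, integral_div, sq,
    Finset.sum_mul_sum]
  rw [integral_finsetSum _ fun i _ => integrable_finsetSum _ fun j _ => hint i j]
  simp_rw [fun i => integral_finsetSum (μ := freqLaw h) Finset.univ fun j _ => hint i j]
  ring

/-- Jensen's inequality for the exponential against a nonnegative integrable weight. -/
theorem exp_integral_weight_mul_le {γ : Measure ℝ} [IsProbabilityMeasure γ] {ω D : ℝ → ℝ}
    (hω : Integrable ω γ) (hω0 : ∀ ξ, 0 ≤ ω ξ) (hW : 0 < ∫ ξ, ω ξ ∂γ) (hD : Measurable D)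
    {M : ℝ} (hM : ∀ ξ, |D ξ| ≤ M) (l : ℝ) :
    Real.exp (l * ∫ ξ, ω ξ * D ξ ∂γ) ≤
      (∫ ξ, ω ξ ∂γ)⁻¹ * ∫ ξ, ω ξ * Real.exp (l * (∫ ξ, ω ξ ∂γ) * D ξ) ∂γ := by
  set W := ∫ ξ, ω ξ ∂γ with hWdef
  obtain ⟨m, hm⟩ : ∃ m, m = l * ∫ ξ, ω ξ * D ξ ∂γ := ⟨_, rfl⟩
  have hDi : Integrable (fun ξ => ω ξ * D ξ) γ :=
    hω.mul_bdd (c := M) hD.aestronglyMeasurable (ae_of_all _ hM)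
  have hEi : Integrable (fun ξ => ω ξ * Real.exp (l * W * D ξ)) γ := by
    refine hω.mul_bdd (c := Real.exp (|l * W| * M)) (hD.const_mul _).exp.aestronglyMeasurable
      (ae_of_all _ fun ξ => ?_)
    rw [Real.norm_eq_abs, abs_of_pos (Real.exp_pos _)]
    refine Real.exp_le_exp.2 ((le_abs_self _).trans ?_)
    rw [abs_mul]
    exact mul_le_mul_of_nonneg_left (hM ξ) (abs_nonneg _)
  rw [← hm, inv_mul_eq_div, le_div_iff₀ hW]
  have h1 : ∫ ξ, (Real.exp m * (1 - m) * ω ξ + Real.exp m * l * W * (ω ξ * D ξ)) ∂γ =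
      Real.exp m * W := by
    rw [integral_add (hω.const_mul _) (hDi.const_mul _), integral_const_mul, integral_const_mul,
      ← hWdef]
    have : Real.exp m * l * W * ∫ ξ, ω ξ * D ξ ∂γ = Real.exp m * W * m := by rw [hm]; ring
    rw [this]; ring
  rw [← h1]
  refine integral_mono ((hω.const_mul _).add (hDi.const_mul _)) hEi fun ξ => ?_
  have h2 : Real.exp m * (1 + (l * W * D ξ - m)) ≤ Real.exp (l * W * D ξ) := by
    have := Real.add_one_le_exp (l * W * D ξ - m)
    have e : Real.exp (l * W * D ξ) = Real.exp m * Real.exp (l * W * D ξ - m) := by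
      rw [← Real.exp_add]; ring_nf
    rw [e]
    nlinarith [Real.exp_pos m]
  have := mul_le_mul_of_nonneg_left h2 (hω0 ξ)
  calc _ = ω ξ * (Real.exp m * (1 + (l * W * D ξ - m))) := by ring
    _ ≤ _ := this

/-- The normalised Hartley feature, bounded by `1` and `1`-Lipschitz in the prediction. -/
noncomputable def feature {X : Type*} (ξ : ℝ) (z : X × ℝ) (t : ℝ) : ℝ :=
  cas (ξ * (z.2 - t)) / (2 * (1 + |ξ|))

theorem abs_feature_le {X : Type*} (ξ : ℝ) (z : X × ℝ) (t : ℝ) : |feature ξ z t| ≤ 1 := by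
  have h0 : 0 < 2 * (1 + |ξ|) := by positivity
  rw [feature, abs_div, abs_of_pos h0, div_le_one h0]
  linarith [abs_cas_le (ξ * (z.2 - t)), abs_nonneg ξ]

theorem abs_feature_sub_le {X : Type*} (ξ : ℝ) (z : X × ℝ) (t t' : ℝ) :
    |feature ξ z t - feature ξ z t'| ≤ |t - t'| := by
  have h0 : 0 < 2 * (1 + |ξ|) := by positivity
  rw [feature, feature, ← sub_div, abs_div, abs_of_pos h0, div_le_iff₀ h0]
  refine (abs_cas_sub_le _ _).trans ?_
  have e : ξ * (z.2 - t) - ξ * (z.2 - t') = ξ * (t' - t) := by ring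
  rw [e, abs_mul, abs_sub_comm t' t]
  nlinarith [abs_nonneg ξ, abs_nonneg (t - t')]

/-- The first moment weight `∫ (1 + |ξ|)` of the spectral measure. -/
noncomputable def freqWeight (h : ℝ) : ℝ := ∫ ξ, (1 + |ξ|) ∂(freqLaw h)

theorem integrable_freqWeight (h : ℝ) : Integrable (fun ξ : ℝ => 1 + |ξ|) (freqLaw h) := by
  refine (integrable_const _).add ?_
  have := (ProbabilityTheory.memLp_id_gaussianReal (μ := 0)
    (v := Real.toNNReal (1 / h ^ 2)) 1).integrable (by norm_num)
  exact this.abs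

theorem freqWeight_pos (h : ℝ) : 0 < freqWeight h := by
  have h1 : ∫ _ξ : ℝ, (1 : ℝ) ∂(freqLaw h) ≤ freqWeight h :=
    integral_mono (integrable_const _) (integrable_freqWeight h) fun ξ => by
      simp
  simp at h1
  linarith

section Deviation

variable {X : Type*} [MeasurableSpace X] {ι : Type*}

/-- The uniform deviation at frequency `ξ` over a finite family. -/
noncomputable def featureDeviation (ρ : Measure (X × ℝ)) (g : ι → X → ℝ) {n : ℕ} (ξ : ℝ)
    (z : Fin n → X × ℝ) : ℝ :=
  ⨆ i, |∑ j, feature ξ (z j) (g i (z j).1) - n * ∫ y, feature ξ y (g i y.1) ∂ρ|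

theorem measurable_feature {Ω : Type*} [MeasurableSpace Ω] {f : X → ℝ} (hf : Measurable f)
    {ξ : Ω → ℝ} (hξ : Measurable ξ) {z : Ω → X × ℝ} (hz : Measurable z) :
    Measurable fun q => feature (ξ q) (z q) (f (z q).1) := by
  unfold feature
  fun_prop

theorem abs_featureDeviation_le [Nonempty ι] (ρ : Measure (X × ℝ)) [IsProbabilityMeasure ρ]
    (g : ι → X → ℝ) {n : ℕ} (ξ : ℝ) (z : Fin n → X × ℝ) :
    |featureDeviation ρ g ξ z| ≤ 2 * n := by
  rw [featureDeviation, abs_of_nonneg (Real.iSup_nonneg fun i => abs_nonneg _)]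
  refine ciSup_le fun i => (abs_sub _ _).trans ?_
  have h1 : |∑ j, feature ξ (z j) (g i (z j).1)| ≤ n :=
    (Finset.abs_sum_le_sum_abs _ _).trans
      ((Finset.sum_le_sum fun j _ => abs_feature_le _ _ _).trans (by simp))
  have h2 : |∫ y, feature ξ y (g i y.1) ∂ρ| ≤ 1 :=
    abs_integral_le_of_abs_le fun y => abs_feature_le _ _ _
  have h3 : (0:ℝ) ≤ n := by positivity
  rw [abs_mul, Nat.abs_cast]
  nlinarith

variable [Finite ι]

theorem measurable_featureDeviation (ρ : Measure (X × ℝ)) [IsProbabilityMeasure ρ]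
    {g : ι → X → ℝ} (hg : ∀ i, Measurable (g i)) {Ω : Type*} [MeasurableSpace Ω] {n : ℕ}
    {ξ : Ω → ℝ} (hξ : Measurable ξ) {z : Ω → Fin n → X × ℝ} (hz : Measurable z) :
    Measurable fun q => featureDeviation ρ g (ξ q) (z q) := by
  unfold featureDeviation
  refine Measurable.iSup fun i => ?_
  have h1 : Measurable fun ξ => ∫ y, feature ξ y (g i y.1) ∂ρ :=
    (StronglyMeasurable.integral_prod_right (f := fun ξ (y : X × ℝ) => feature ξ y (g i y.1))
      (measurable_feature (hg i) measurable_fst measurable_snd).stronglyMeasurable).measurable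
  have h2 : ∀ j : Fin n, Measurable fun q => feature (ξ q) (z q j) (g i (z q j).1) := fun j =>
    measurable_feature (hg i) hξ ((measurable_pi_apply j).comp hz)
  have h3 : Measurable fun q => ∑ j, feature (ξ q) (z q j) (g i (z q j).1) :=
    Finset.measurable_fun_sum _ fun j _ => h2 j
  exact continuous_abs.measurable.comp (h3.sub ((h1.comp hξ).const_mul _))

variable [Nonempty ι]

/-- Normalizing the feature makes the bound uniform in the frequency. The price is the weight 1 +
|ξ|, which has finite integral against the Gaussian law. -/
theorem integral_exp_featureDeviation_le (ρ : Measure (X × ℝ)) [IsProbabilityMeasure ρ]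
    {H : Set (X → ℝ)} {c s : ℝ} (hc : 0 < c)
    (hs : 0 < s) (hs2 : s < 2) (hcov : ∀ ε : ℝ≥0, 0 < ε →
      ENNReal.log (empiricalCoveringNumber H ε : ℝ≥0∞) ≤ ((c * (ε : ℝ) ^ (-s) : ℝ) : EReal))
    {g : ι → X → ℝ} (hg : ∀ i, Measurable (g i)) (hgH : ∀ i, g i ∈ H) (n : ℕ) (ξ : ℝ) {l : ℝ}
    (hl : 0 ≤ l) :
    ∫ z : Fin n → X × ℝ, Real.exp (l * featureDeviation ρ g ξ z) ∂(Measure.pi fun _ => ρ) ≤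
      2 * Real.exp (l ^ 2 * (4 * n) * chainConst c (2 ^ s)) :=
  integral_exp_iSup_deviation_le ρ (fun i z => feature ξ z (g i z.1))
    (fun i => measurable_feature (hg i) measurable_const measurable_id)
    (fun _ _ => abs_feature_le _ _ _) hl fun w =>
      sum_exp_rademacher_le hc hs hs2 hcov g hgH Prod.fst (feature ξ)
        (abs_feature_le ξ) (abs_feature_sub_le ξ) w hl

/-- Both potentials are frequency averages of squares, so a² - b² = (a - b)(a + b) reduces the
matter to a difference of means. The constant 8 is 4, bounding |a + b|, times the 2 in the
normalization of the feature. -/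
theorem abs_potential_deviation_le (ρ : Measure (X × ℝ)) [IsProbabilityMeasure ρ]
    {g : ι → X → ℝ} (hg : ∀ i, Measurable (g i)) {n : ℕ} (hn : 0 < n) {h : ℝ} (hh : 0 < h)
    (z : Fin n → X × ℝ) (i : ι) :
    |-informationError ρ h (g i) - empiricalPotential h z (g i)| ≤
      8 * kernelScale h / n * ∫ ξ, (1 + |ξ|) * featureDeviation ρ g ξ z ∂(freqLaw h) := by
  have hn' : (0 : ℝ) < n := by exact_mod_cast hn
  set a : ℝ → ℝ := fun ξ => ∫ y, cas (ξ * (y.2 - g i y.1)) ∂ρ with ha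
  set b : ℝ → ℝ := fun ξ => (∑ j, cas (ξ * ((z j).2 - g i (z j).1))) / n with hb
  have ha2 : ∀ ξ, |a ξ| ≤ 2 := fun ξ => abs_integral_le_of_abs_le fun y => abs_cas_le _
  have hb2 : ∀ ξ, |b ξ| ≤ 2 := by
    intro ξ
    simp only [hb]
    rw [abs_div, Nat.abs_cast, div_le_iff₀ hn']
    refine (Finset.abs_sum_le_sum_abs _ _).trans
      ((Finset.sum_le_sum fun j _ => abs_cas_le _).trans (by simp [mul_comm]))
  have ham : Measurable a := by
    have : Measurable fun q : ℝ × (X × ℝ) => cas (q.1 * (q.2.2 - g i q.2.1)) := by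
      have := hg i
      fun_prop
    exact (StronglyMeasurable.integral_prod_right
      (f := fun ξ (y : X × ℝ) => cas (ξ * (y.2 - g i y.1))) this.stronglyMeasurable).measurable
  have hbm : Measurable b := by fun_prop
  have hsq : ∀ t : ℝ, |t| ≤ 2 → |t ^ 2| ≤ 4 := by
    intro t ht
    rw [abs_pow]
    nlinarith [abs_nonneg t]
  have hDm : Measurable fun ξ => featureDeviation ρ g ξ z :=
    measurable_featureDeviation ρ hg measurable_id measurable_const
  have hDi : Integrable (fun ξ => (1 + |ξ|) * featureDeviation ρ g ξ z) (freqLaw h) :=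
    (integrable_freqWeight h).mul_bdd (c := 2 * n) hDm.aestronglyMeasurable
      (ae_of_all _ fun ξ => abs_featureDeviation_le ρ g ξ z)
  have key : ∀ ξ, |a ξ ^ 2 - b ξ ^ 2| ≤ 8 / n * ((1 + |ξ|) * featureDeviation ρ g ξ z) := by
    intro ξ
    have h0 : 0 < 2 * (1 + |ξ|) := by positivity
    have h1 : b ξ - a ξ = 2 * (1 + |ξ|) / n * (∑ j, feature ξ (z j) (g i (z j).1) -
        n * ∫ y, feature ξ y (g i y.1) ∂ρ) := by
      simp only [ha, hb, feature, ← Finset.sum_div, integral_div]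
      field_simp
    have h2 := le_iSup_of_finite (fun i => |∑ j, feature ξ (z j) (g i (z j).1) -
        n * ∫ y, feature ξ y (g i y.1) ∂ρ|) i
    have h3 : |b ξ - a ξ| ≤ 2 * (1 + |ξ|) / n * featureDeviation ρ g ξ z := by
      rw [h1, abs_mul, abs_of_pos (by positivity : 0 < 2 * (1 + |ξ|) / (n : ℝ))]
      exact mul_le_mul_of_nonneg_left h2 (by positivity)
    have h4 : |a ξ + b ξ| ≤ 4 := (abs_add_le _ _).trans (by linarith [ha2 ξ, hb2 ξ])
    calc |a ξ ^ 2 - b ξ ^ 2| = |b ξ - a ξ| * |a ξ + b ξ| := by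
          rw [abs_sub_comm (b ξ), ← abs_mul]; congr 1; ring
      _ ≤ (2 * (1 + |ξ|) / n * featureDeviation ρ g ξ z) * 4 :=
          mul_le_mul h3 h4 (abs_nonneg _) ((abs_nonneg _).trans h3)
      _ = _ := by ring
  rw [informationError_eq_cas ρ h (hg i), neg_neg, empiricalPotential_eq_cas, ← mul_sub,
    abs_mul, abs_of_pos (kernelScale_pos hh), ← integral_sub
      (integrable_of_abs_le (ham.pow_const 2) fun ξ => hsq _ (ha2 ξ))
      (integrable_of_abs_le (hbm.pow_const 2) fun ξ => hsq _ (hb2 ξ))]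
  have h5 : |∫ ξ, (a ξ ^ 2 - b ξ ^ 2) ∂(freqLaw h)| ≤
      8 / n * ∫ ξ, (1 + |ξ|) * featureDeviation ρ g ξ z ∂(freqLaw h) := by
    rw [← integral_const_mul]
    exact abs_integral_le_integral_abs.trans (integral_mono_of_nonneg
      (ae_of_all _ fun _ => abs_nonneg _) (hDi.const_mul _) (ae_of_all _ key))
  calc _ ≤ kernelScale h * (8 / n * ∫ ξ, (1 + |ξ|) * featureDeviation ρ g ξ z ∂(freqLaw h)) :=
        mul_le_mul_of_nonneg_left h5 (kernelScale_pos hh).le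
    _ = _ := by ring

/-- Jensen over the normalized frequency weight moves the exponential inside the frequency integral.
After Fubini the bound at a single frequency applies, with `l * freqWeight h` in place of `l`. -/
theorem integral_exp_weighted_deviation_le (ρ : Measure (X × ℝ)) [IsProbabilityMeasure ρ]
    {H : Set (X → ℝ)} {c s : ℝ} (hc : 0 < c)
    (hs : 0 < s) (hs2 : s < 2) (hcov : ∀ ε : ℝ≥0, 0 < ε →
      ENNReal.log (empiricalCoveringNumber H ε : ℝ≥0∞) ≤ ((c * (ε : ℝ) ^ (-s) : ℝ) : EReal))
    {g : ι → X → ℝ} (hg : ∀ i, Measurable (g i)) (hgH : ∀ i, g i ∈ H) (n : ℕ) (h : ℝ) {l : ℝ}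
    (hl : 0 ≤ l) :
    ∫ z : Fin n → X × ℝ,
      Real.exp (l * ∫ ξ, (1 + |ξ|) * featureDeviation ρ g ξ z ∂(freqLaw h))
        ∂(Measure.pi fun _ => ρ) ≤
      2 * Real.exp ((l * freqWeight h) ^ 2 * (4 * n) * chainConst c (2 ^ s)) := by
  set P := Measure.pi fun _ : Fin n => ρ
  set γ := freqLaw h
  set W := freqWeight h with hW
  have hW0 : 0 < W := freqWeight_pos h
  set F : ℝ → (Fin n → X × ℝ) → ℝ := fun ξ z =>
    (1 + |ξ|) * Real.exp (l * W * featureDeviation ρ g ξ z) with hF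
  have hFint : Integrable (Function.uncurry F) (γ.prod P) := by
    have h1 : Integrable (fun q : ℝ × (Fin n → X × ℝ) => 1 + |q.1|) (γ.prod P) :=
      (integrable_freqWeight h).comp_fst P
    refine h1.mul_bdd (c := Real.exp (l * W * (2 * n)))
      ((measurable_featureDeviation ρ hg measurable_fst measurable_snd).const_mul _).exp.aestronglyMeasurable (ae_of_all _ fun q => ?_)
    rw [Real.norm_eq_abs, abs_of_pos (Real.exp_pos _)]
    exact Real.exp_le_exp.2 (mul_le_mul_of_nonneg_left
      ((le_abs_self _).trans (abs_featureDeviation_le ρ g q.1 q.2)) (by positivity))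
  calc _ ≤ ∫ z, W⁻¹ * ∫ ξ, F ξ z ∂γ ∂P := by
        refine integral_mono_of_nonneg (ae_of_all _ fun _ => (Real.exp_pos _).le)
          (hFint.integral_prod_right.const_mul _) (ae_of_all _ fun z => ?_)
        exact exp_integral_weight_mul_le (integrable_freqWeight h) (fun ξ => by positivity) hW0
          (measurable_featureDeviation ρ hg measurable_id measurable_const)
          (fun ξ => abs_featureDeviation_le ρ g ξ z) l
    _ = W⁻¹ * ∫ ξ, ∫ z, F ξ z ∂P ∂γ := by
        rw [integral_const_mul, integral_integral_swap hFint]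
    _ ≤ W⁻¹ * ∫ ξ, (1 + |ξ|) *
          (2 * Real.exp ((l * W) ^ 2 * (4 * n) * chainConst c (2 ^ s))) ∂γ := by
        refine mul_le_mul_of_nonneg_left ?_ (inv_nonneg.2 hW0.le)
        refine integral_mono hFint.integral_prod_left ((integrable_freqWeight h).mul_const _)
          fun ξ => ?_
        simp only [hF]
        rw [integral_const_mul]
        exact mul_le_mul_of_nonneg_left (integral_exp_featureDeviation_le ρ hc hs hs2 hcov hg hgH
          n ξ (by positivity)) (by positivity)
    _ = _ := by
        rw [integral_mul_const, ← freqWeight, ← hW, ← mul_assoc, inv_mul_cancel₀ hW0.ne', one_mul]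

/-- The constant in the exponential deviation inequality. -/
noncomputable def deviationConst (h c s : ℝ) : ℝ :=
  1024 * kernelScale h ^ 2 * freqWeight h ^ 2 * chainConst c (2 ^ s)

theorem chainConst_pos {c s : ℝ} (hc : 0 < c) (hs2 : s < 2) :
    0 < chainConst c (2 ^ s) := by
  have hp4 : (2 : ℝ) ^ s < 2 ^ 2 := by
    calc (2 : ℝ) ^ s < 2 ^ (2 : ℝ) := Real.rpow_lt_rpow_of_exponent_lt (by norm_num) hs2
      _ = 2 ^ 2 := by norm_num
  have h1 : Real.sqrt (2 ^ s) < 2 := (Real.sqrt_lt' (by norm_num)).2 hp4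
  have h2 : 0 < 1 - Real.sqrt (2 ^ s) / 2 := by linarith
  have h3 : 0 < Real.log 2 := Real.log_pos (by norm_num)
  unfold chainConst
  positivity

theorem deviationConst_pos {h c s : ℝ} (hh : 0 < h) (hc : 0 < c) (hs2 : s < 2) :
    0 < deviationConst h c s := by
  have := chainConst_pos hc hs2
  have := kernelScale_pos hh
  have := freqWeight_pos h
  unfold deviationConst
  positivity

theorem measure_exists_deviation_le (ρ : Measure (X × ℝ)) [IsProbabilityMeasure ρ]
    {H : Set (X → ℝ)} {c s : ℝ} (hc : 0 < c)
    (hs : 0 < s) (hs2 : s < 2) (hcov : ∀ ε : ℝ≥0, 0 < ε →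
      ENNReal.log (empiricalCoveringNumber H ε : ℝ≥0∞) ≤ ((c * (ε : ℝ) ^ (-s) : ℝ) : EReal))
    {g : ι → X → ℝ} (hg : ∀ i, Measurable (g i)) (hgH : ∀ i, g i ∈ H) {n : ℕ} (hn : 0 < n)
    {h : ℝ} (hh : 0 < h) {t : ℝ} (ht : 0 ≤ t) :
    (Measure.pi fun _ : Fin n => ρ)
      {z | ∃ i, t < |-informationError ρ h (g i) - empiricalPotential h z (g i)|} ≤
      ENNReal.ofReal (2 * Real.exp (-(n * t ^ 2 / deviationConst h c s))) := by
  have hn' : (0 : ℝ) < n := by exact_mod_cast hn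
  set P := Measure.pi fun _ : Fin n => ρ
  have hA := kernelScale_pos hh
  set A := kernelScale h with hAdef
  have hW := freqWeight_pos h
  set W := freqWeight h with hWdef
  have hK := chainConst_pos hc hs2
  set K := chainConst c (2 ^ s) with hKdef
  set V : (Fin n → X × ℝ) → ℝ := fun z =>
    ∫ ξ, (1 + |ξ|) * featureDeviation ρ g ξ z ∂(freqLaw h)
  have hVm : Measurable V := by
    have : Measurable fun q : (Fin n → X × ℝ) × ℝ => (1 + |q.2|) * featureDeviation ρ g q.2 q.1 :=
      (by fun_prop : Measurable fun q : (Fin n → X × ℝ) × ℝ => 1 + |q.2|).mul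
        (measurable_featureDeviation ρ hg measurable_snd measurable_fst)
    exact (StronglyMeasurable.integral_prod_right
      (f := fun (z : Fin n → X × ℝ) ξ => (1 + |ξ|) * featureDeviation ρ g ξ z)
      this.stronglyMeasurable).measurable
  have hVb : ∀ z, V z ≤ W * (2 * n) := by
    intro z
    rw [hWdef, freqWeight, ← integral_mul_const]
    refine integral_mono ((integrable_freqWeight h).mul_bdd (c := 2 * n)
      (measurable_featureDeviation ρ hg measurable_id measurable_const).aestronglyMeasurable
      (ae_of_all _ fun ξ => abs_featureDeviation_le ρ g ξ z))
      ((integrable_freqWeight h).mul_const _) fun ξ => ?_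
    exact mul_le_mul_of_nonneg_left
      ((le_abs_self _).trans (abs_featureDeviation_le ρ g ξ z)) (by positivity)
  set u : ℝ := n * t / (8 * A) with hu
  -- The Chernoff parameter minimizing -lu + 4n l²W²K. The minimum is -u²/(16nW²K), and u = nt/(8A)
  -- turns it into -nt²/(1024A²W²K).
  set l : ℝ := u / (8 * n * W ^ 2 * K) with hl
  have hl0 : 0 ≤ l := by positivity
  have hsub : {z | ∃ i, t < |-informationError ρ h (g i) - empiricalPotential h z (g i)|} ⊆
      {z | u ≤ V z} := by
    rintro z ⟨i, hi⟩
    have h1 := hi.trans_le (abs_potential_deviation_le ρ hg hn hh z i)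
    change u ≤ V z
    rw [hu, div_le_iff₀ (by positivity)]
    have h2 : t * n < 8 * A * V z := by
      have h3 : t * n < 8 * A / n * V z * n := mul_lt_mul_of_pos_right h1 hn'
      have e : 8 * A / n * V z * n = 8 * A * V z := by field_simp
      rwa [e] at h3
    linarith
  have hexpi : Integrable (fun z => Real.exp (l * V z)) P := by
    refine integrable_of_abs_le (C := Real.exp (l * (W * (2 * n)))) (hVm.const_mul _).exp
      fun z => ?_
    rw [abs_of_pos (Real.exp_pos _)]
    exact Real.exp_le_exp.2 (mul_le_mul_of_nonneg_left (hVb z) hl0)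
  have hch := ProbabilityTheory.measure_ge_le_exp_mul_mgf (μ := P) (X := V) u hl0 hexpi
  have hmgf : ProbabilityTheory.mgf V P l ≤ 2 * Real.exp ((l * W) ^ 2 * (4 * n) * K) :=
    integral_exp_weighted_deviation_le ρ hc hs hs2 hcov hg hgH n h hl0
  refine (measure_mono hsub).trans ?_
  rw [← ENNReal.ofReal_toReal (measure_ne_top P {z | u ≤ V z})]
  refine ENNReal.ofReal_le_ofReal (hch.trans ((mul_le_mul_of_nonneg_left hmgf
    (Real.exp_pos _).le).trans (le_of_eq ?_)))
  rw [mul_left_comm, ← Real.exp_add]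
  congr 2
  rw [hl, hu, deviationConst, ← hAdef, ← hWdef, ← hKdef]
  field_simp
  ring

end Deviation

end MEE

/-! ### From finite families to the whole hypothesis space -/

namespace MEE

/-- A class of continuous functions has a sequence approximating each member simultaneously at
finitely many points of a separable set and in the value of a given functional. -/
theorem exists_seq_approximating {X : Type*} [MetricSpace X] {S : Set X}
    (hS : TopologicalSpace.IsSeparable S) {H : Set (X → ℝ)} (hne : H.Nonempty)
    (hcont : ∀ f ∈ H, Continuous f) (Φ : (X → ℝ) → ℝ) :
    ∃ g : ℕ → X → ℝ, (∀ k, g k ∈ H) ∧ ∀ f ∈ H, ∀ (n : ℕ) (x : Fin n → X), (∀ j, x j ∈ S) →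
      ∀ η : ℝ, 0 < η → ∃ k, (∀ j, |g k (x j) - f (x j)| < η) ∧ |Φ (g k) - Φ f| < η := by
  classical
  obtain ⟨D, hD, hSD⟩ := hS
  have : Countable D := hD.to_subtype
  -- A countable set of tests: finitely many balls with centers in `D` and rational radii, a
  -- rational target value on each, a rational target for `Φ`, and a common tolerance. One member of
  -- `H` is picked for every test that can be passed. No regularity of `Φ` is needed, as it is only
  -- one more real coordinate.
  let I := Σ n : ℕ, (Fin n → D × ℚ × ℚ) × ℚ × ℚ
  let good : I → (X → ℝ) → Prop := fun a f => f ∈ H ∧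
    (∀ j, ∀ y ∈ Metric.ball ((a.2.1 j).1 : X) ((a.2.1 j).2.1 : ℝ),
      |f y - ((a.2.1 j).2.2 : ℝ)| < (a.2.2.2 : ℝ)) ∧ |Φ f - (a.2.2.1 : ℝ)| < (a.2.2.2 : ℝ)
  let pick : I → X → ℝ := fun a => if ha : ∃ f, good a f then ha.choose else hne.choose
  have hpickH : ∀ a, pick a ∈ H := by
    intro a
    by_cases ha : ∃ f, good a f
    · simp only [pick, ha, dif_pos]
      exact ha.choose_spec.1
    · simp only [pick, ha, dif_neg, not_false_eq_true]
      exact hne.choose_spec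
  have : Nonempty I := ⟨⟨0, Fin.elim0, 0, 0⟩⟩
  obtain ⟨e, he⟩ := exists_surjective_nat I
  refine ⟨fun k => pick (e k), fun k => hpickH _, fun f hf n x hx η hη => ?_⟩
  -- Two functions passing the same test differ by less than 2δ < η.
  obtain ⟨δ, hδ0, hδ⟩ := exists_rat_btwn (half_pos hη)
  have hδ0' : (0 : ℝ) < δ := by exact_mod_cast hδ0
  have hloc : ∀ j, ∃ a : D × ℚ × ℚ, x j ∈ Metric.ball (a.1 : X) (a.2.1 : ℝ) ∧
      ∀ y ∈ Metric.ball (a.1 : X) (a.2.1 : ℝ), |f y - (a.2.2 : ℝ)| < δ := by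
    intro j
    obtain ⟨q, hq1, hq2⟩ := exists_rat_btwn (show f (x j) - δ / 2 < f (x j) by linarith)
    obtain ⟨r, hr0, hr⟩ := Metric.continuous_iff.1 (hcont f hf) (x j) (δ / 2) (by positivity)
    obtain ⟨r', hr'0, hr'⟩ := exists_rat_btwn (half_pos hr0)
    have hr'0' : (0 : ℝ) < r' := by exact_mod_cast hr'0
    obtain ⟨d, hd, hdx⟩ := Metric.mem_closure_iff.1 (hSD (hx j)) r' hr'0'
    refine ⟨⟨⟨d, hd⟩, r', q⟩, hdx, fun y hy => ?_⟩
    have h1 : dist y (x j) < r := by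
      have h2 : dist y d < r' := hy
      have := dist_triangle y d (x j)
      rw [dist_comm d] at this
      linarith
    have h3 := abs_lt.1 (hr y h1)
    change |f y - (q : ℝ)| < δ
    rw [abs_lt]
    constructor <;> linarith [h3.1, h3.2]
  choose a ha1 ha2 using hloc
  obtain ⟨q, hq1, hq2⟩ := exists_rat_btwn (show Φ f - δ < Φ f by linarith)
  obtain ⟨k, hk⟩ := he ⟨n, a, q, δ⟩
  have hex : ∃ f, good ⟨n, a, q, δ⟩ f :=
    ⟨f, hf, ha2, by change |Φ f - (q : ℝ)| < δ; rw [abs_lt]; constructor <;> linarith⟩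
  have hgood : good ⟨n, a, q, δ⟩ (pick (e k)) := by
    rw [hk]
    simp only [pick, hex, dif_pos]
    exact hex.choose_spec
  refine ⟨k, fun j => ?_, ?_⟩
  · have h1 := abs_lt.1 (hgood.2.1 j (x j) (ha1 j))
    have h2 := abs_lt.1 (ha2 j (x j) (ha1 j))
    rw [abs_lt]
    constructor <;> linarith [h1.1, h1.2, h2.1, h2.2]
  · have h1 := abs_lt.1 hgood.2.2
    have h2 : |Φ f - (q : ℝ)| < δ := by rw [abs_lt]; constructor <;> linarith
    have h3 := abs_lt.1 h2
    rw [abs_lt]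
    constructor <;> linarith [h1.1, h1.2, h3.1, h3.2]

theorem continuous_gaussKernel (h : ℝ) : Continuous (gaussKernel h) := by
  unfold gaussKernel
  fun_prop

/-- Uniform exponential deviation inequality over the whole hypothesis space, for the outer
measure. -/
theorem measure_exists_mem_deviation_le {X : Type*} [MetricSpace X] [MeasurableSpace X]
    [BorelSpace X] (ρ : Measure (X × ℝ)) [IsProbabilityMeasure ρ]
    (hsep : ∃ S : Set X, TopologicalSpace.IsSeparable S ∧ ∀ᵐ x ∂ρ.fst, x ∈ S)
    {H : Set (X → ℝ)} (hcont : ∀ f ∈ H, Continuous f) {c s : ℝ} (hc : 0 < c)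
    (hs : 0 < s) (hs2 : s < 2) (hcov : ∀ ε : ℝ≥0, 0 < ε →
      ENNReal.log (empiricalCoveringNumber H ε : ℝ≥0∞) ≤ ((c * (ε : ℝ) ^ (-s) : ℝ) : EReal))
    {n : ℕ} (hn : 0 < n) {h : ℝ} (hh : 0 < h) {t : ℝ} (ht : 0 ≤ t) :
    (Measure.pi fun _ : Fin n => ρ)
      {z | ∃ f ∈ H, t < |-informationError ρ h f - empiricalPotential h z f|} ≤
      ENNReal.ofReal (2 * Real.exp (-(n * t ^ 2 / deviationConst h c s))) := by
  set P := Measure.pi fun _ : Fin n => ρ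
  rcases H.eq_empty_or_nonempty with rfl | hne
  · simp
  obtain ⟨S, hS, hSae⟩ := hsep
  obtain ⟨g, hgH, hg⟩ := exists_seq_approximating hS hne hcont (informationError ρ h)
  have hgm : ∀ k, Measurable (g k) := fun k => (hcont _ (hgH k)).measurable
  set E : ℕ → Set (Fin n → X × ℝ) := fun m =>
    {z | ∃ i : Fin (m + 1), t < |-informationError ρ h (g i) - empiricalPotential h z (g i)|}
  have hEmono : Monotone E := by
    rintro m m' hm z ⟨i, hi⟩
    exact ⟨⟨i, by omega⟩, hi⟩
  have hae : ∀ᵐ z ∂P, ∀ j, (z j).1 ∈ S := by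
    rw [ae_all_iff]
    intro j
    have h1 : ∀ᵐ y ∂ρ, y.1 ∈ S := ae_of_ae_map measurable_fst.aemeasurable hSae
    exact (measurePreserving_eval (fun _ : Fin n => ρ) j).quasiMeasurePreserving.ae h1
  have hsub : {z | ∃ f ∈ H, t < |-informationError ρ h f - empiricalPotential h z f|} ≤ᵐ[P]
      ⋃ m, E m := by
    filter_upwards [hae] with z hz
    rintro ⟨f, hf, hft⟩
    -- For a fixed sample, a deviation exceeding `t` is an open condition on the values of `f` at
    -- the sample and on its information error. Hence some member of the sequence violates the bound
    -- as well.
    set R : (Fin n → ℝ) × ℝ → ℝ := fun q => |-q.2 - 1 / (n : ℝ) ^ 2 * ∑ i, ∑ j,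
      gaussKernel h (((z i).2 - q.1 i) - ((z j).2 - q.1 j))|
    have hRc : Continuous R := by
      have := continuous_gaussKernel h
      fun_prop
    obtain ⟨η, hη, hball⟩ := Metric.isOpen_iff.1 (isOpen_lt continuous_const hRc)
      ((fun j => f (z j).1), informationError ρ h f) hft
    obtain ⟨k, hk1, hk2⟩ := hg f hf n (fun j => (z j).1) hz η hη
    have hmem : ((fun j => g k (z j).1), informationError ρ h (g k)) ∈
        Metric.ball ((fun j => f (z j).1), informationError ρ h f) η := by
      rw [Metric.mem_ball, Prod.dist_eq, max_lt_iff]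
      exact ⟨(dist_pi_lt_iff hη).2 fun j => hk1 j, hk2⟩
    exact mem_iUnion.2 ⟨k, ⟨⟨k, Nat.lt_succ_self k⟩, hball hmem⟩⟩
  refine (measure_mono_ae hsub).trans ?_
  rw [hEmono.measure_iUnion]
  exact iSup_le fun m => measure_exists_deviation_le ρ hc hs hs2 hcov
    (g := fun i : Fin (m + 1) => g i) (fun i => hgm i) (fun i => hgH i) hn hh ht

end MEE

/-! ### Population comparison: excess information error against variance -/

namespace MEE

section Trigonometric

variable {X : Type*} [MeasurableSpace X] (μ : Measure X) [IsProbabilityMeasure μ]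

/-- Expanding |∫ φ e^{iθ}|² as a double integral leaves cos(θ x - θ y). The deficit then has a
nonnegative integrand as soon as φ ≥ 0. -/
theorem sq_integral_sub_trig {φ θ : X → ℝ} (hφ : Measurable φ) (hθ : Measurable θ)
    (hφ1 : ∀ x, |φ x| ≤ 1) :
    (∫ x, φ x ∂μ) ^ 2 - ((∫ x, φ x * Real.cos (θ x) ∂μ) ^ 2 +
      (∫ x, φ x * Real.sin (θ x) ∂μ) ^ 2) =
      ∫ x, φ x * ∫ y, φ y * (1 - Real.cos (θ x - θ y)) ∂μ ∂μ := by
  have h0 : Integrable φ μ := integrable_of_abs_le hφ hφ1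
  have hc : Integrable (fun x => φ x * Real.cos (θ x)) μ :=
    integrable_of_abs_le (by fun_prop) fun x => by
      rw [abs_mul]
      exact mul_le_one₀ (hφ1 x) (abs_nonneg _) (Real.abs_cos_le_one _)
  have hs : Integrable (fun x => φ x * Real.sin (θ x)) μ :=
    integrable_of_abs_le (by fun_prop) fun x => by
      rw [abs_mul]
      exact mul_le_one₀ (hφ1 x) (abs_nonneg _) (Real.abs_sin_le_one _)
  have hin : ∀ x, ∫ y, φ y * (1 - Real.cos (θ x - θ y)) ∂μ =
      ∫ y, φ y ∂μ - Real.cos (θ x) * ∫ y, φ y * Real.cos (θ y) ∂μ -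
        Real.sin (θ x) * ∫ y, φ y * Real.sin (θ y) ∂μ := by
    intro x
    have hi : Integrable (fun y => φ y - Real.cos (θ x) * (φ y * Real.cos (θ y))) μ :=
      h0.sub (hc.const_mul _)
    rw [← integral_const_mul, ← integral_const_mul, ← integral_sub h0 (hc.const_mul _),
      ← integral_sub hi (hs.const_mul _)]
    refine integral_congr_ae (ae_of_all _ fun y => ?_)
    simp only [Real.cos_sub]
    ring
  simp_rw [hin]
  generalize hN : ∫ y, φ y ∂μ = N
  generalize hC : ∫ y, φ y * Real.cos (θ y) ∂μ = C
  generalize hS : ∫ y, φ y * Real.sin (θ y) ∂μ = S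
  have e : ∀ x, φ x * (N - Real.cos (θ x) * C - Real.sin (θ x) * S) =
      φ x * N - φ x * Real.cos (θ x) * C - φ x * Real.sin (θ x) * S := fun x => by ring
  simp_rw [e]
  have hi : Integrable (fun x => φ x * N - φ x * Real.cos (θ x) * C) μ :=
    (h0.mul_const _).sub (hc.mul_const _)
  rw [integral_sub hi (hs.mul_const _),
    integral_sub (h0.mul_const _) (hc.mul_const _), integral_mul_const, integral_mul_const,
    integral_mul_const, hN, hC, hS]
  ring

theorem sq_integral_trig_le {φ θ : X → ℝ} (hφ : Measurable φ) (hθ : Measurable θ)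
    (hφ0 : ∀ x, 0 ≤ φ x) (hφ1 : ∀ x, |φ x| ≤ 1) :
    (∫ x, φ x * Real.cos (θ x) ∂μ) ^ 2 + (∫ x, φ x * Real.sin (θ x) ∂μ) ^ 2 ≤
      (∫ x, φ x ∂μ) ^ 2 := by
  rw [← sub_nonneg, sq_integral_sub_trig μ hφ hθ hφ1]
  exact integral_nonneg fun x => mul_nonneg (hφ0 x) (integral_nonneg fun y =>
    mul_nonneg (hφ0 y) (by linarith [Real.cos_le_one (θ x - θ y)]))

theorem integral_sub_sq {θ : X → ℝ} (hθ : Measurable θ) {B : ℝ} (hB : ∀ x, |θ x| ≤ B) (a : ℝ) :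
    ∫ y, (a - θ y) ^ 2 ∂μ =
      (a - ∫ y, θ y ∂μ) ^ 2 + ∫ y, (θ y - ∫ x, θ x ∂μ) ^ 2 ∂μ := by
  obtain ⟨m, hm⟩ : ∃ m, m = ∫ y, θ y ∂μ := ⟨_, rfl⟩
  have h0 : Integrable θ μ := integrable_of_abs_le hθ hB
  have h2 : Integrable (fun y => (θ y - m) ^ 2) μ := by
    refine integrable_of_abs_le (C := (B + |m|) ^ 2) (by fun_prop) fun y => ?_
    rw [abs_pow]
    have := (abs_sub (θ y) m).trans (by linarith [hB y] : _ ≤ B + |m|)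
    gcongr
  have e : ∀ y, (a - θ y) ^ 2 = (a - m) ^ 2 + (θ y - m) ^ 2 - 2 * (a - m) * (θ y - m) :=
    fun y => by ring
  have h3 : Integrable (fun y => (a - m) ^ 2 + (θ y - m) ^ 2) μ := (integrable_const _).add h2
  have h4 : Integrable (fun y => θ y - m) μ := h0.sub (integrable_const _)
  rw [← hm]
  simp_rw [e]
  rw [integral_sub h3 (h4.const_mul _), integral_add (integrable_const _) h2,
    integral_const_mul, integral_sub h0 (integrable_const _), ← hm]
  simp

/-- Phases within π/2 differ by at most π, where 1 - cos u ≥ 2u²/π². Since ∬ (θ x - θ y)² is twice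
the variance, the constant is C² · 4/π². -/
theorem sq_integral_trig_add_variance_le {φ θ : X → ℝ} (hφ : Measurable φ) (hθ : Measurable θ)
    {C : ℝ} (hC : 0 ≤ C) (hφC : ∀ x, C ≤ φ x) (hφ1 : ∀ x, |φ x| ≤ 1)
    (hθb : ∀ x, |θ x| ≤ Real.pi / 2) :
    (∫ x, φ x * Real.cos (θ x) ∂μ) ^ 2 + (∫ x, φ x * Real.sin (θ x) ∂μ) ^ 2 +
      C ^ 2 * (4 / Real.pi ^ 2) * ∫ x, (θ x - ∫ y, θ y ∂μ) ^ 2 ∂μ ≤ (∫ x, φ x ∂μ) ^ 2 := by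
  rw [← le_sub_iff_add_le', sq_integral_sub_trig μ hφ hθ hφ1]
  set κ : ℝ := 2 / Real.pi ^ 2 with hκ
  have hκ0 : 0 ≤ κ := by positivity
  obtain ⟨V, hV⟩ : ∃ V, V = ∫ x, (θ x - ∫ y, θ y ∂μ) ^ 2 ∂μ := ⟨_, rfl⟩
  obtain ⟨m, hm⟩ : ∃ m, m = ∫ y, θ y ∂μ := ⟨_, rfl⟩
  have hV0 : 0 ≤ V := hV ▸ integral_nonneg fun x => sq_nonneg _
  have hm2 : Integrable (fun y => (θ y - m) ^ 2) μ := by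
    refine integrable_of_abs_le (C := (Real.pi / 2 + |m|) ^ 2) (by fun_prop) fun y => ?_
    rw [abs_pow]
    have := (abs_sub (θ y) m).trans (by linarith [hθb y] : _ ≤ Real.pi / 2 + |m|)
    gcongr
  have hsq : ∀ x, Integrable (fun y => (θ x - θ y) ^ 2) μ := by
    intro x
    refine integrable_of_abs_le (C := Real.pi ^ 2) (by fun_prop) fun y => ?_
    rw [abs_pow]
    have := (abs_sub (θ x) (θ y)).trans (by linarith [hθb x, hθb y] : _ ≤ Real.pi)
    gcongr
  have hinm : ∀ x, ∀ y, |φ y * (1 - Real.cos (θ x - θ y))| ≤ 2 := by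
    intro x y
    rw [abs_mul]
    have h1 : |1 - Real.cos (θ x - θ y)| ≤ 2 := by
      rw [abs_le]
      constructor <;> linarith [Real.cos_le_one (θ x - θ y), Real.neg_one_le_cos (θ x - θ y)]
    nlinarith [hφ1 y, abs_nonneg (φ y), abs_nonneg (1 - Real.cos (θ x - θ y))]
  have hpt : ∀ x y, C * κ * (θ x - θ y) ^ 2 ≤ φ y * (1 - Real.cos (θ x - θ y)) := by
    intro x y
    have h1 : |θ x - θ y| ≤ Real.pi :=
      (abs_sub (θ x) (θ y)).trans (by linarith [hθb x, hθb y])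
    have h2 : κ * (θ x - θ y) ^ 2 ≤ 1 - Real.cos (θ x - θ y) := by
      have := Real.cos_le_one_sub_mul_cos_sq h1
      linarith
    calc C * κ * (θ x - θ y) ^ 2 = C * (κ * (θ x - θ y) ^ 2) := by ring
      _ ≤ φ y * (1 - Real.cos (θ x - θ y)) :=
        mul_le_mul (hφC y) h2 (by positivity) (hC.trans (hφC y))
  have hin : ∀ x, C * κ * ((θ x - m) ^ 2 + V) ≤
      ∫ y, φ y * (1 - Real.cos (θ x - θ y)) ∂μ := by
    intro x
    rw [hm, hV, ← integral_sub_sq μ hθ hθb, ← integral_const_mul]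
    exact integral_mono ((hsq x).const_mul _)
      (integrable_of_abs_le (by fun_prop) (hinm x)) (hpt x)
  have hmeas : Measurable fun x => ∫ y, φ y * (1 - Real.cos (θ x - θ y)) ∂μ :=
    (StronglyMeasurable.integral_prod_right
      (f := fun x y => φ y * (1 - Real.cos (θ x - θ y)))
      (by fun_prop : Measurable fun q : X × X =>
        φ q.2 * (1 - Real.cos (θ q.1 - θ q.2))).stronglyMeasurable).measurable
  calc C ^ 2 * (4 / Real.pi ^ 2) * ∫ x, (θ x - ∫ y, θ y ∂μ) ^ 2 ∂μ
      = ∫ x, C * (C * κ * ((θ x - m) ^ 2 + V)) ∂μ := by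
        rw [integral_const_mul, integral_const_mul, integral_add hm2 (integrable_const _),
          hm, ← hV, hκ]
        simp
        ring
    _ ≤ _ := by
        refine integral_mono (((hm2.add (integrable_const _)).const_mul _).const_mul _)
          (integrable_of_abs_le (C := 2) (hφ.mul hmeas) fun x => ?_) fun x => ?_
        · rw [abs_mul]
          have h1 := abs_integral_le_of_abs_le (μ := μ) (hinm x)
          nlinarith [hφ1 x, abs_nonneg (φ x),
            abs_nonneg (∫ y, φ y * (1 - Real.cos (θ x - θ y)) ∂μ)]
        · exact mul_le_mul (hφC x) (hin x) (by positivity) (hC.trans (hφC x))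

end Trigonometric

section Model

variable {X : Type*} [MeasurableSpace X] {ρ : Measure (X × ℝ)}
  {fstar : X → ℝ} {p : X → ℝ → ℝ}

theorem IsRegressionModel.integrable_density (hm : IsRegressionModel ρ fstar p) (x : X) :
    Integrable (p x) := by
  refine ⟨(hm.measurable_density.of_uncurry_left).aestronglyMeasurable, ?_⟩
  rw [hasFiniteIntegral_iff_ofReal (ae_of_all _ (hm.density_nonneg x)), hm.lintegral_density]
  exact ENNReal.one_lt_top

theorem IsRegressionModel.integral_density (hm : IsRegressionModel ρ fstar p) (x : X) :
    ∫ t, p x t = 1 := by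
  rw [integral_eq_lintegral_of_nonneg_ae (ae_of_all _ (hm.density_nonneg x))
    (hm.integrable_density x).aestronglyMeasurable, hm.lintegral_density, ENNReal.toReal_one]

/-- The real part of the noise characteristic function given `X = x`. -/
noncomputable def noiseChar (p : X → ℝ → ℝ) (ξ : ℝ) (x : X) : ℝ :=
  ∫ t, p x t * Real.cos (ξ * t)

theorem fourierHat_re_im (hm : IsRegressionModel ρ fstar p) (x : X) (ξ : ℝ) :
    (fourierHat (p x) ξ).re = noiseChar p ξ x ∧
      (fourierHat (p x) ξ).im = -∫ t, p x t * Real.sin (ξ * t) := by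
  have e : ∀ t : ℝ, (p x t : ℂ) * Complex.exp (-(Complex.I * t * ξ)) =
      (p x t : ℂ) * Complex.exp (((-(ξ * t) : ℝ) : ℂ) * Complex.I) := by
    intro t
    congr 2
    push_cast
    ring
  have hint : Integrable fun t : ℝ =>
      (p x t : ℂ) * Complex.exp (-(Complex.I * t * ξ)) := by
    refine (hm.integrable_density x).ofReal.mul_bdd (c := 1) (by fun_prop)
      (ae_of_all _ fun t => ?_)
    have : -(Complex.I * t * ξ) = ((-(ξ * t) : ℝ) : ℂ) * Complex.I := by push_cast; ring
    rw [this, Complex.norm_exp_ofReal_mul_I]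
  constructor
  · refine Eq.trans (integral_re (𝕜 := ℂ) hint).symm ?_
    refine integral_congr_ae (ae_of_all _ fun t => ?_)
    simp only [e, RCLike.re_to_complex, Complex.re_ofReal_mul, Complex.exp_ofReal_mul_I_re,
      Real.cos_neg]
  · rw [← integral_neg]
    refine Eq.trans (integral_im (𝕜 := ℂ) hint).symm ?_
    refine integral_congr_ae (ae_of_all _ fun t => ?_)
    simp only [e, RCLike.im_to_complex, Complex.im_ofReal_mul, Complex.exp_ofReal_mul_I_im,
      Real.sin_neg, mul_neg]

theorem measurable_noiseChar (hm : IsRegressionModel ρ fstar p) (ξ : ℝ) :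
    Measurable (noiseChar p ξ) := by
  have hp : Measurable fun q : X × ℝ => p q.1 q.2 := hm.measurable_density
  exact (StronglyMeasurable.integral_prod_right (f := fun x t => p x t * Real.cos (ξ * t))
    (by fun_prop : Measurable fun q : X × ℝ =>
      p q.1 q.2 * Real.cos (ξ * q.2)).stronglyMeasurable).measurable

theorem integrable_density_mul (hm : IsRegressionModel ρ fstar p) (x : X) {F : ℝ → ℝ}
    (hF : Measurable F) (hF1 : ∀ t, |F t| ≤ 1) : Integrable fun t => p x t * F t :=
  (hm.integrable_density x).mul_bdd (c := 1) hF.aestronglyMeasurable (ae_of_all _ hF1)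

theorem abs_noiseChar_le (hm : IsRegressionModel ρ fstar p) (ξ : ℝ) (x : X) :
    |noiseChar p ξ x| ≤ 1 := by
  rw [← hm.integral_density x]
  refine abs_integral_le_integral_abs.trans (integral_mono_of_nonneg
    (ae_of_all _ fun _ => abs_nonneg _) (hm.integrable_density x) (ae_of_all _ fun t => ?_))
  change |p x t * Real.cos (ξ * t)| ≤ p x t
  rw [abs_mul, abs_of_nonneg (hm.density_nonneg x t)]
  exact mul_le_of_le_one_right (hm.density_nonneg x t) (Real.abs_cos_le_one _)

theorem noiseChar_nonneg (hm : IsRegressionModel ρ fstar p) (hP : IsNoiseClassP1 p) (ξ : ℝ)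
    (x : X) : 0 ≤ noiseChar p ξ x := by
  rw [← (fourierHat_re_im hm x ξ).1]
  exact (hP.fourier_nonneg x ξ).2

theorem adjustedSqError_eq_variance (f : X → ℝ) :
    adjustedSqError ρ fstar f =
      ∫ x, ((fstar x - f x) - ∫ y, (fstar y - f y) ∂ρ.fst) ^ 2 ∂ρ.fst := by
  refine integral_congr_ae (ae_of_all _ fun x => ?_)
  simp only [adjustment]
  ring

variable [IsProbabilityMeasure ρ]

theorem IsRegressionModel.integral_comp_noise (hm : IsRegressionModel ρ fstar p)
    {F : X × ℝ → ℝ} (hF : Measurable F) {C : ℝ} (hC : ∀ q, |F q| ≤ C) :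
    ∫ z, F (z.1, z.2 - fstar z.1) ∂ρ = ∫ x, (∫ t, p x t * F (x, t)) ∂ρ.fst := by
  have hf := hm.measurable_fstar
  have hp : Measurable fun q : X × ℝ => p q.1 q.2 := hm.measurable_density
  have hmap : Measurable fun z : X × ℝ => (z.1, z.2 - fstar z.1) := by fun_prop
  have h1 : ∫ z, F (z.1, z.2 - fstar z.1) ∂ρ =
      ∫ q, F q ∂(ρ.map fun z => (z.1, z.2 - fstar z.1)) :=
    (integral_map hmap.aemeasurable hF.aestronglyMeasurable).symm
  have hpi : Integrable (fun q : X × ℝ => p q.1 q.2) (ρ.fst.prod volume) := by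
    refine ⟨hp.aestronglyMeasurable, ?_⟩
    rw [hasFiniteIntegral_iff_ofReal (ae_of_all _ fun q : X × ℝ => hm.density_nonneg q.1 q.2),
      lintegral_prod _ hp.ennreal_ofReal.aemeasurable]
    simp [hm.lintegral_density]
  rw [h1, hm.law_noise, integral_withDensity_eq_integral_toReal_smul hp.ennreal_ofReal
    (ae_of_all _ fun _ => ENNReal.ofReal_lt_top)]
  simp_rw [fun q : X × ℝ => ENNReal.toReal_ofReal (hm.density_nonneg q.1 q.2), smul_eq_mul]
  exact integral_prod _ (hpi.mul_bdd (c := C) hF.aestronglyMeasurable (ae_of_all _ hC))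

/-- The squared modulus of the characteristic function of the error `Y - f(X)`. -/
noncomputable def errorCharSq (ρ : Measure (X × ℝ)) (f : X → ℝ) (ξ : ℝ) : ℝ :=
  (∫ z, Real.cos (ξ * (z.2 - f z.1)) ∂ρ) ^ 2 + (∫ z, Real.sin (ξ * (z.2 - f z.1)) ∂ρ) ^ 2

theorem informationError_eq_errorCharSq (h : ℝ) {f : X → ℝ} (hf : Measurable f) :
    informationError ρ h f = -(kernelScale h * ∫ ξ, errorCharSq ρ f ξ ∂(freqLaw h)) := by
  rw [informationError_eq_cos ρ h hf]
  congr 3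
  ext ξ
  have hc : Integrable (fun z : X × ℝ => Real.cos (ξ * (z.2 - f z.1))) ρ :=
    integrable_of_abs_le (by fun_prop) fun z => Real.abs_cos_le_one _
  have hs : Integrable (fun z : X × ℝ => Real.sin (ξ * (z.2 - f z.1))) ρ :=
    integrable_of_abs_le (by fun_prop) fun z => Real.abs_sin_le_one _
  simp_rw [mul_sub ξ (_ - _), Real.cos_sub]
  have hin : ∀ z : X × ℝ, ∫ z', (Real.cos (ξ * (z.2 - f z.1)) * Real.cos (ξ * (z'.2 - f z'.1)) +
      Real.sin (ξ * (z.2 - f z.1)) * Real.sin (ξ * (z'.2 - f z'.1))) ∂ρ =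
      Real.cos (ξ * (z.2 - f z.1)) * ∫ z', Real.cos (ξ * (z'.2 - f z'.1)) ∂ρ +
      Real.sin (ξ * (z.2 - f z.1)) * ∫ z', Real.sin (ξ * (z'.2 - f z'.1)) ∂ρ := by
    intro z
    rw [integral_add (hc.const_mul _) (hs.const_mul _), integral_const_mul, integral_const_mul]
  simp_rw [hin]
  rw [integral_add (hc.mul_const _) (hs.mul_const _), integral_mul_const, integral_mul_const,
    errorCharSq, sq, sq]

theorem integrable_errorCharSq (h : ℝ) {f : X → ℝ} (hf : Measurable f) :
    Integrable (errorCharSq ρ f) (freqLaw h) := by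
  have hc : Measurable fun ξ => ∫ z, Real.cos (ξ * (z.2 - f z.1)) ∂ρ :=
    (StronglyMeasurable.integral_prod_right
      (f := fun ξ (z : X × ℝ) => Real.cos (ξ * (z.2 - f z.1)))
      (by fun_prop : Measurable fun q : ℝ × (X × ℝ) =>
        Real.cos (q.1 * (q.2.2 - f q.2.1))).stronglyMeasurable).measurable
  have hs : Measurable fun ξ => ∫ z, Real.sin (ξ * (z.2 - f z.1)) ∂ρ :=
    (StronglyMeasurable.integral_prod_right
      (f := fun ξ (z : X × ℝ) => Real.sin (ξ * (z.2 - f z.1)))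
      (by fun_prop : Measurable fun q : ℝ × (X × ℝ) =>
        Real.sin (q.1 * (q.2.2 - f q.2.1))).stronglyMeasurable).measurable
  refine integrable_of_abs_le (C := 2) ((hc.pow_const 2).add (hs.pow_const 2)) fun ξ => ?_
  have h1 := abs_integral_le_of_abs_le (μ := ρ)
    fun z => Real.abs_cos_le_one (ξ * (z.2 - f z.1))
  have h2 := abs_integral_le_of_abs_le (μ := ρ)
    fun z => Real.abs_sin_le_one (ξ * (z.2 - f z.1))
  have h3 := (sq_le_one_iff_abs_le_one _).2 h1
  have h4 := (sq_le_one_iff_abs_le_one _).2 h2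
  rw [errorCharSq, abs_of_nonneg (by positivity)]
  linarith

/-- The characteristic function of the noise is real, so the sine integrals drop out and the noise
enters only as an amplitude, with f* - f as the phase. -/
theorem errorCharSq_eq (hm : IsRegressionModel ρ fstar p) (hP : IsNoiseClassP1 p) {f : X → ℝ}
    (hf : Measurable f) (ξ : ℝ) :
    errorCharSq ρ f ξ =
      (∫ x, noiseChar p ξ x * Real.cos (ξ * (fstar x - f x)) ∂ρ.fst) ^ 2 +
      (∫ x, noiseChar p ξ x * Real.sin (ξ * (fstar x - f x)) ∂ρ.fst) ^ 2 := by
  have hfs := hm.measurable_fstar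
  have hsin : ∀ x, ∫ t, p x t * Real.sin (ξ * t) = 0 := by
    intro x
    have h1 := (fourierHat_re_im hm x ξ).2
    rw [(hP.fourier_nonneg x ξ).1] at h1
    linarith
  have hci : ∀ x, Integrable fun t => p x t * Real.cos (ξ * t) := fun x =>
    integrable_density_mul hm x (by fun_prop) fun t => Real.abs_cos_le_one _
  have hsi : ∀ x, Integrable fun t => p x t * Real.sin (ξ * t) := fun x =>
    integrable_density_mul hm x (by fun_prop) fun t => Real.abs_sin_le_one _
  have e : ∀ z : X × ℝ, ξ * (z.2 - f z.1) =
      ξ * (z.2 - fstar z.1) + ξ * (fstar z.1 - f z.1) := fun z => by ring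
  unfold errorCharSq
  congr 2
  · simp_rw [e]
    rw [hm.integral_comp_noise
      (F := fun q => Real.cos (ξ * q.2 + ξ * (fstar q.1 - f q.1))) (by fun_prop)
      (fun _ => Real.abs_cos_le_one _)]
    refine integral_congr_ae (ae_of_all _ fun x => ?_)
    have e2 : ∀ t, p x t * Real.cos (ξ * t + ξ * (fstar x - f x)) =
        p x t * Real.cos (ξ * t) * Real.cos (ξ * (fstar x - f x)) -
        p x t * Real.sin (ξ * t) * Real.sin (ξ * (fstar x - f x)) := by
      intro t
      rw [Real.cos_add]
      ring
    simp_rw [e2]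
    rw [integral_sub ((hci x).mul_const _) ((hsi x).mul_const _), integral_mul_const,
      integral_mul_const, hsin, zero_mul, sub_zero, noiseChar]
  · simp_rw [e]
    rw [hm.integral_comp_noise
      (F := fun q => Real.sin (ξ * q.2 + ξ * (fstar q.1 - f q.1))) (by fun_prop)
      (fun _ => Real.abs_sin_le_one _)]
    refine integral_congr_ae (ae_of_all _ fun x => ?_)
    have e2 : ∀ t, p x t * Real.sin (ξ * t + ξ * (fstar x - f x)) =
        p x t * Real.sin (ξ * t) * Real.cos (ξ * (fstar x - f x)) +
        p x t * Real.cos (ξ * t) * Real.sin (ξ * (fstar x - f x)) := by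
      intro t
      rw [Real.sin_add]
      ring
    simp_rw [e2]
    rw [integral_add ((hsi x).mul_const _) ((hci x).mul_const _), integral_mul_const,
      integral_mul_const, hsin, zero_mul, zero_add, noiseChar]

theorem errorCharSq_fstar_add_const (hm : IsRegressionModel ρ fstar p) (hP : IsNoiseClassP1 p)
    (b ξ : ℝ) :
    errorCharSq ρ (fun x => fstar x + b) ξ = (∫ x, noiseChar p ξ x ∂ρ.fst) ^ 2 := by
  rw [errorCharSq_eq hm hP (hm.measurable_fstar.add_const b)]
  simp only [sub_add_cancel_left, integral_mul_const]
  rw [mul_pow, mul_pow, ← mul_add, Real.cos_sq_add_sin_sq, mul_one]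

/-- The inequality holds frequency by frequency: for f* + b the phase is constant and the squared
modulus attains its largest possible value. -/
theorem informationError_fstar_add_const_le (hm : IsRegressionModel ρ fstar p)
    (hP : IsNoiseClassP1 p) {h : ℝ} (hh : 0 < h) (b : ℝ) {f : X → ℝ} (hf : Measurable f) :
    informationError ρ h (fun x => fstar x + b) ≤ informationError ρ h f := by
  have hfb : Measurable fun x => fstar x + b := hm.measurable_fstar.add_const b
  have hfs := hm.measurable_fstar
  rw [informationError_eq_errorCharSq h hfb, informationError_eq_errorCharSq h hf]
  refine neg_le_neg (mul_le_mul_of_nonneg_left ?_ (kernelScale_pos hh).le)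
  refine integral_mono (integrable_errorCharSq h hf) (integrable_errorCharSq h hfb) fun ξ => ?_
  rw [errorCharSq_fstar_add_const hm hP, errorCharSq_eq hm hP hf]
  exact sq_integral_trig_le ρ.fst (measurable_noiseChar hm ξ) (by fun_prop)
    (noiseChar_nonneg hm hP ξ) (abs_noiseChar_le hm ξ)

/-- Comparison of the adjusted squared error with the excess information error. -/
theorem exists_adjustedSqError_le_excess (hm : IsRegressionModel ρ fstar p)
    (hP : IsNoiseClassP1 p) {h : ℝ} (hh : 0 < h) {M : ℝ} (hM : 0 < M) :
    ∃ K : ℝ, 0 < K ∧ ∀ f : X → ℝ, Measurable f → (∀ x, |fstar x - f x| ≤ M) →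
      K * adjustedSqError ρ fstar f ≤ informationError ρ h f - informationError ρ h fstar := by
  obtain ⟨c₀, C₀, hc₀, hC₀, hlow⟩ := hP.fourier_lower
  have hfs := hm.measurable_fstar
  have hpi := Real.pi_pos
  set a : ℝ := min (c₀ / 2) (Real.pi / (4 * M)) with ha
  have ha0 : 0 < a := lt_min (by positivity) (by positivity)
  -- On the band [a, 2a] the amplitude is at least `C₀`, the phases stay within π/2, and ξ ≥ a keeps
  -- the variance of ξ(f* - f) from degenerating.
  have ha1 : 2 * a ≤ c₀ := by linarith [min_le_left (c₀ / 2) (Real.pi / (4 * M))]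
  have ha2 : 2 * a * M ≤ Real.pi / 2 := by
    have h1 := min_le_right (c₀ / 2) (Real.pi / (4 * M))
    rw [← ha, le_div_iff₀ (by positivity)] at h1
    linarith
  set γ := freqLaw h
  have hmass : 0 < γ.real (Icc a (2 * a)) := by
    have hv : Real.toNNReal (1 / h ^ 2) ≠ 0 := by
      rw [Ne, Real.toNNReal_eq_zero, not_le]
      positivity
    have h1 : γ (Icc a (2 * a)) ≠ 0 := by
      intro h0
      have h2 := ProbabilityTheory.gaussianReal_absolutelyContinuous' 0 hv h0
      rw [Real.volume_Icc, ENNReal.ofReal_eq_zero] at h2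
      linarith
    exact ENNReal.toReal_pos h1 (measure_ne_top _ _)
  set D : ℝ := C₀ ^ 2 * (4 / Real.pi ^ 2) * a ^ 2 with hD
  have hD0 : 0 < D := by positivity
  have hA := kernelScale_pos hh
  refine ⟨kernelScale h * (γ.real (Icc a (2 * a)) * D), by positivity, fun f hf hfM => ?_⟩
  obtain ⟨V, hV⟩ : ∃ V, V = adjustedSqError ρ fstar f := ⟨_, rfl⟩
  have hV0 : 0 ≤ V := hV ▸ integral_nonneg fun x => sq_nonneg _
  have hstar : ∀ ξ, errorCharSq ρ fstar ξ = (∫ x, noiseChar p ξ x ∂ρ.fst) ^ 2 := by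
    intro ξ
    simpa using errorCharSq_fstar_add_const hm hP 0 ξ
  -- Frequencies outside the band contribute a nonnegative deficit, so the gain on the band survives
  -- integration.
  have hpt : ∀ ξ, (Icc a (2 * a)).indicator (fun _ => D * V) ξ ≤
      errorCharSq ρ fstar ξ - errorCharSq ρ f ξ := by
    intro ξ
    rw [hstar, errorCharSq_eq hm hP hf]
    by_cases hξ : ξ ∈ Icc a (2 * a)
    · rw [indicator_of_mem hξ]
      have hξ0 : 0 < ξ := ha0.trans_le hξ.1
      have hmain := sq_integral_trig_add_variance_le ρ.fst (φ := noiseChar p ξ)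
        (θ := fun x => ξ * (fstar x - f x)) (measurable_noiseChar hm ξ) (by fun_prop) hC₀.le
        (fun x => by
          rw [← (fourierHat_re_im hm x ξ).1]
          exact hlow x ξ ⟨by linarith, by linarith [hξ.2]⟩)
        (abs_noiseChar_le hm ξ) (fun x => by
          rw [abs_mul, abs_of_pos hξ0]
          calc ξ * |fstar x - f x| ≤ 2 * a * M :=
                mul_le_mul hξ.2 (hfM x) (abs_nonneg _) (by positivity)
            _ ≤ _ := ha2)
      have hvar : ∫ x, (ξ * (fstar x - f x) - ∫ y, ξ * (fstar y - f y) ∂ρ.fst) ^ 2 ∂ρ.fst =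
          ξ ^ 2 * V := by
        rw [hV, adjustedSqError_eq_variance, ← integral_const_mul, integral_const_mul]
        refine integral_congr_ae (ae_of_all _ fun x => ?_)
        simp only
        ring
      rw [hvar] at hmain
      have h3 : D * V ≤ C₀ ^ 2 * (4 / Real.pi ^ 2) * (ξ ^ 2 * V) := by
        have h4 : a ^ 2 ≤ ξ ^ 2 := by gcongr; exact hξ.1
        rw [hD, mul_assoc]
        gcongr
      linarith
    · rw [indicator_of_notMem hξ]
      exact sub_nonneg.2 (sq_integral_trig_le ρ.fst (measurable_noiseChar hm ξ) (by fun_prop)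
        (noiseChar_nonneg hm hP ξ) (abs_noiseChar_le hm ξ))
  have hi1 := integrable_errorCharSq (ρ := ρ) h hfs
  have hi2 := integrable_errorCharSq (ρ := ρ) h hf
  have hint := integral_mono ((integrable_const (D * V)).indicator measurableSet_Icc)
    (hi1.sub hi2) hpt
  rw [integral_indicator measurableSet_Icc, setIntegral_const, smul_eq_mul] at hint
  have hsub : ∫ ξ, (errorCharSq ρ fstar - errorCharSq ρ f) ξ ∂γ =
      ∫ ξ, errorCharSq ρ fstar ξ ∂γ - ∫ ξ, errorCharSq ρ f ξ ∂γ := integral_sub hi1 hi2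
  rw [hsub] at hint
  rw [informationError_eq_errorCharSq h hf, informationError_eq_errorCharSq h hfs, ← hV]
  have := mul_le_mul_of_nonneg_left hint hA.le
  linarith

end Model

end MEE

/-! ### Convergence rate and conclusion -/

namespace MEE

theorem gaussKernel_pos {h : ℝ} (hh : 0 < h) (t : ℝ) : 0 < gaussKernel h t := by
  unfold gaussKernel
  have := Real.pi_pos
  positivity

theorem empiricalPotential_pos {X : Type*} {n : ℕ} (hn : 1 ≤ n) {h : ℝ} (hh : 0 < h)
    (z : Fin n → X × ℝ) (f : X → ℝ) : 0 < empiricalPotential h z f := by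
  have hn' : (0 : ℝ) < n := by exact_mod_cast hn
  have : Nonempty (Fin n) := ⟨⟨0, hn⟩⟩
  refine mul_pos (by positivity) (Finset.sum_pos (fun i _ => Finset.sum_pos
    (fun j _ => gaussKernel_pos hh _) Finset.univ_nonempty) Finset.univ_nonempty)

/-- Minimizing -log of the potential is maximizing the potential. The logarithms are comparable
because both potentials are positive, which uses n ≥ 1. -/
theorem IsEmpiricalMinimizer.empiricalPotential_le {X : Type*} {n : ℕ} {H : Set (X → ℝ)}
    (hn : 1 ≤ n) {h : ℝ} (hh : 0 < h) {z : Fin n → X × ℝ} {f g : X → ℝ}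
    (hf : IsEmpiricalMinimizer H h z f) (hg : g ∈ H) :
    empiricalPotential h z g ≤ empiricalPotential h z f :=
  (Real.log_le_log_iff (empiricalPotential_pos hn hh z g) (empiricalPotential_pos hn hh z f)).1
    (neg_le_neg_iff.1 (hf.2 g hg))

/-- The convergence rate of the adjusted MEE algorithm with fixed bandwidth. -/
theorem exists_rate_const {X : Type*} [MetricSpace X] [MeasurableSpace X] [BorelSpace X]
    {ρ : Measure (X × ℝ)} [IsProbabilityMeasure ρ]
    (hsep : ∃ S : Set X, TopologicalSpace.IsSeparable S ∧ ∀ᵐ x ∂ρ.fst, x ∈ S)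
    {fstar : X → ℝ} {p : X → ℝ → ℝ} (hmodel : IsRegressionModel ρ fstar p)
    {H : Set (X → ℝ)} (hH : IsAdmissibleSpace ρ fstar H) (hP1 : IsNoiseClassP1 p)
    {h : ℝ} (hh : 0 < h) :
    ∃ C : ℝ, 0 < C ∧ ∀ fz : (n : ℕ) → (Fin n → X × ℝ) → X → ℝ, IsMEEAlgorithm ρ H h fz →
      ∀ n : ℕ, 1 ≤ n → ∀ δ : ℝ, 0 < δ → δ < 1 →
        (Measure.pi fun _ : Fin n => ρ)
          {z | C * Real.sqrt (Real.log (2 / δ)) * (n : ℝ) ^ (-(1 / 2) : ℝ) <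
            adjustedSqError ρ fstar (fz n z)} ≤ ENNReal.ofReal δ := by
  obtain ⟨M, hM⟩ := hH.bounded
  obtain ⟨c, s, hc, hs, hs2, hcov⟩ := hH.covering
  -- Both f* and f_z lie in `H`, so they differ by at most 2|M|. The summand 1 only ensures
  -- positivity.
  obtain ⟨K, hK, hexcess⟩ := exists_adjustedSqError_le_excess hmodel hP1 hh
    (M := 2 * |M| + 1) (by positivity)
  set κ := deviationConst h c s
  have hκ0 : 0 < κ := deviationConst_pos hh hc hs2
  refine ⟨2 * √κ / K, by positivity, fun fz hfz n hn δ hδ0 hδ1 => ?_⟩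
  have hn' : (0 : ℝ) < n := by exact_mod_cast hn
  have hlog : 0 ≤ Real.log (2 / δ) := Real.log_nonneg (by rw [le_div_iff₀ hδ0]; linarith)
  -- Chosen so that 2 exp(-nt²/κ) = δ. The factor 2 in the constant pays for two deviations, one at
  -- f* and one at f_z.
  set t : ℝ := √κ * √(Real.log (2 / δ)) * (n : ℝ) ^ (-(1 / 2) : ℝ) with ht
  have ht0 : 0 ≤ t := by positivity
  have hsub : {z | 2 * √κ / K * Real.sqrt (Real.log (2 / δ)) * (n : ℝ) ^ (-(1 / 2) : ℝ) <
      adjustedSqError ρ fstar (fz n z)} ≤ᵐ[Measure.pi fun _ : Fin n => ρ]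
      {z | ∃ f ∈ H, t < |-informationError ρ h f - empiricalPotential h z f|} := by
    filter_upwards [hfz n hn] with z hz hlt
    have hb : ∀ x, |fstar x - fz n z x| ≤ 2 * |M| + 1 := by
      intro x
      refine (abs_sub _ _).trans ?_
      linarith [hM _ hH.fstar_mem x, hM _ hz.1 x, le_abs_self M]
    have h1 := hexcess _ (hH.continuous _ hz.1).measurable hb
    have h2 : 2 * t < K * adjustedSqError ρ fstar (fz n z) := by
      have h3 : 2 * √κ / K * Real.sqrt (Real.log (2 / δ)) * (n : ℝ) ^ (-(1 / 2) : ℝ) <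
        adjustedSqError ρ fstar (fz n z) := hlt
      have h4 := mul_lt_mul_of_pos_left h3 hK
      refine lt_of_eq_of_lt ?_ h4
      rw [ht]
      field_simp
    have h5 := hz.empiricalPotential_le hn hh hH.fstar_mem
    -- If all deviations were at most `t`, optimality of f_z would force an excess of at most 2t,
    -- contradicting `h1` and `h2`.
    by_contra hcon
    have h6 : ∀ f ∈ H, |-informationError ρ h f - empiricalPotential h z f| ≤ t :=
      fun f hf => not_lt.1 fun h' => hcon ⟨f, hf, h'⟩
    have h7 := abs_le.1 (h6 _ hH.fstar_mem)
    have h8 := abs_le.1 (h6 _ hz.1)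
    linarith [h7.2, h8.1]
  refine (measure_mono_ae hsub).trans ((measure_exists_mem_deviation_le ρ hsep hH.continuous
    hc hs hs2 hcov hn hh ht0).trans (ENNReal.ofReal_le_ofReal (le_of_eq ?_)))
  have h9 : (n : ℝ) * t ^ 2 / κ = Real.log (2 / δ) := by
    have h10 : ((n : ℝ) ^ (-(1 / 2) : ℝ)) ^ 2 = (n : ℝ)⁻¹ := by
      rw [← Real.rpow_natCast, ← Real.rpow_mul hn'.le, ← Real.rpow_neg_one]
      norm_num
    rw [ht, mul_pow, mul_pow, Real.sq_sqrt hκ0.le, Real.sq_sqrt hlog, h10]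
    field_simp
  rw [h9, Real.exp_neg, Real.exp_log (by positivity)]
  field_simp

end MEE

theorem mainTheorem5 {X : Type*} [MetricSpace X] [MeasurableSpace X] [BorelSpace X]
    (ρ : Measure (X × ℝ)) [IsProbabilityMeasure ρ]
    (hsep : ∃ S : Set X, TopologicalSpace.IsSeparable S ∧ ∀ᵐ x ∂ρ.fst, x ∈ S)
    (fstar : X → ℝ) (p : X → ℝ → ℝ)
    (hmodel : MEE.IsRegressionModel ρ fstar p)
    (hadm : MEE.IsAdmissibleModel ρ fstar p)
    (H : Set (X → ℝ)) (hH : MEE.IsAdmissibleSpace ρ fstar H)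
    (hP1 : MEE.IsNoiseClassP1 p) :
    (∀ h : ℝ, 0 < h → ∀ b : ℝ,
      MEE.IsInformationErrorMinimizer ρ h (fun x => fstar x + b)) ∧
    ∀ h : ℝ, 0 < h →
      (∀ fz : (n : ℕ) → (Fin n → X × ℝ) → X → ℝ, MEE.IsMEEAlgorithm ρ H h fz →
        ∀ ε : ℝ, 0 < ε →
          Tendsto (fun n : ℕ => (Measure.pi fun _ : Fin n => ρ)
            {z | ε < MEE.adjustedSqError ρ fstar (fz n z)}) atTop (𝓝 0)) ∧
      ∃ C : ℝ, 0 < C ∧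
        ∀ fz : (n : ℕ) → (Fin n → X × ℝ) → X → ℝ, MEE.IsMEEAlgorithm ρ H h fz →
          ∀ n : ℕ, 1 ≤ n → ∀ δ : ℝ, 0 < δ → δ < 1 →
            (Measure.pi fun _ : Fin n => ρ)
              {z | C * Real.sqrt (Real.log (2 / δ)) * (n : ℝ) ^ (-(1 / 2) : ℝ) <
                MEE.adjustedSqError ρ fstar (fz n z)} ≤ ENNReal.ofReal δ := by
  refine ⟨fun h hh b => ⟨hmodel.measurable_fstar.add_const b, fun g hg =>
    MEE.informationError_fstar_add_const_le hmodel hP1 hh b hg⟩, fun h hh => ?_⟩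
  obtain ⟨C, hC, hrate⟩ := MEE.exists_rate_const hsep hmodel hH hP1 hh
  refine ⟨fun fz hfz ε hε => ?_, C, hC, hrate⟩
  rw [ENNReal.tendsto_nhds_zero]
  intro a ha
  -- Consistency from the rate: with the confidence level δ ≤ a fixed, the bound falls below ε for
  -- large n.
  obtain ⟨δ, hδ0, hδ1, hδa⟩ : ∃ δ : ℝ, 0 < δ ∧ δ < 1 ∧ ENNReal.ofReal δ ≤ a := by
    obtain ⟨r, hr0, hr⟩ := ENNReal.lt_iff_exists_real_btwn.1 (lt_min ha one_pos)
    have h1 := lt_min_iff.1 hr.2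
    exact ⟨r, ENNReal.ofReal_pos.1 hr.1, ENNReal.ofReal_lt_one.1 h1.2, h1.1.le⟩
  have hlim : Tendsto (fun n : ℕ => C * Real.sqrt (Real.log (2 / δ)) * (n : ℝ) ^ (-(1 / 2) : ℝ))
      atTop (𝓝 0) := by
    have := ((tendsto_rpow_neg_atTop (show (0 : ℝ) < 1 / 2 by norm_num)).comp
      tendsto_natCast_atTop_atTop).const_mul (C * Real.sqrt (Real.log (2 / δ)))
    simpa using this
  filter_upwards [hlim.eventually_lt_const hε, eventually_ge_atTop 1] with n hn1 hn2
  exact (measure_mono fun z (hz : ε < _) => hn1.trans hz).trans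
    ((hrate fz hfz n hn2 δ hδ0 hδ1).trans hδa)
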